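/- Let $G$ be a finite pseudograph without loops (multiple edges are allowed) with nodes $v_1,\dots,v_n$, $n\ge 1$, and edges $e_1,\dots,e_k$. Assume that $G$ is connected or has no multiple edges. A *tube* of $G$ is a proper, nonempty, connected subgraph that contains at least one edge between any two of its nodes that are adjacent in $G$. Two tubes are *compatible* if one properly contains the other, or if they are disjoint and no edge of $G$ joins them. A *tubing* is a set of pairwise compatible tubes that does not contain all the connected components of $G$. Let $|G|$ be the number of nodes and edges of $G$, let $c=|G|^2$, and for a subgraph $t$ let $|G-t|$ be the number of nodes and edges of $G$ that are not in $t$. A *bundle* is the set of all edges joining some given pair of adjacent nodes; let $B_1,\dots,B_m$ be the bundles of $G$ and $b_i=|B_i|$. For a subgraph $t$ let $V(t)$ be its node set and $E(i,t)$ the set of edges of $B_i$ in $t$, and put $$\Lambda(t)=c^{|V(t)|}+\sum_{i=1}^m c^{|E(i,t)|}+|G-t|^2 .$$ Then for every maximal tubing $T$ of $G$ there is exactly one integer-valued function $f_T$ on the nodes and edges of $G$ with the following properties. 1. The edges of each bundle $B_i$ can be ordered as $e(i,1),\dots,e(i,b_i)$ so that the number of tubes of $T$ not containing $e(i,j)$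 strictly increases with $j$; for $1\le j<b_i$ there is a largest tube $G_{e(i,j)}$ of $T$ that contains $e(i,j)$ but not $e(i,j+1)$; and $$f_T(e(i,1))=c+\sum_{x=1}^{b_i-1}\bigl(2|G-G_{e(i,x)}|-1\bigr),$$ $$f_T(e(i,j))=c^{\,j-1}(c-1)-\bigl(2|G-G_{e(i,j-1)}|-1\bigr)\quad(2\le j\le b_i).$$ 2. The sum of $f_T$ over all nodes and edges of $t$ equals $\Lambda(t)$ for every tube $t\in T$ and for $t=G$. Let $P\subset\mathbb R^{n+k}$ be the convex hull of the points $\bigl(f_T(v_1),\dots,f_T(v_n),f_T(e_1),\dots,f_T(e_k)\bigr)$, where $T$ runs over the maximal tubings of $G$. Then $P$ realizes the pseudograph associahedron $\mathcal KG$: it is a simple convex polytope of dimension $n-1+r$, where $r$ is the least number of edges whose removal from $G$ leaves a simple graph, and there is an isomorphism from the poset of tubings of $G$, ordered by reverse inclusion, onto the poset of nonempty faces of $P$, ordered by inclusion, that takes each tubing with $m$ tubes to a face of codimension $m$. Explicitly, this isomorphism takes a tubing $T_0$ to the convex hull of the points of the maximal tubings $T\supseteq T_0$. -/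

import Mathlib

namespace PseudographAssociahedron

open scoped Graph

/-! ### Tubes and tubings of a pseudograph -/

section Tubes

variable {α β : Type*}

/-- A pseudograph is connected if it has a node and any two of its nodes are joined by a walk. -/
def IsConnected (G : Graph α β) : Prop :=
  V(G).Nonempty ∧ ∀ x ∈ V(G), ∀ y ∈ V(G), Relation.ReflTransGen G.Adj x y

/-- The connected components of `G`: its maximal connected subgraphs. -/
def components (G : Graph α β) : Set (Graph α β) :=
  {H | Maximal (fun K => K ≤ G ∧ IsConnected K) H}

/-- A tube of `G`: a proper connected subgraph that includes at least one edge between every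
pair of its nodes that are joined by an edge of `G`. -/
structure IsTube (G t : Graph α β) : Prop where
  le : t ≤ G
  ne : t ≠ G
  connected : IsConnected t
  adj : ∀ x ∈ V(t), ∀ y ∈ V(t), G.Adj x y → t.Adj x y

/-- Two tubes are compatible if one properly contains the other, or if they are disjoint and
cannot be connected by a single edge of `G`. -/
def TubesCompatible (G s t : Graph α β) : Prop :=
  s < t ∨ t < s ∨ (Disjoint V(s) V(t) ∧ ∀ x ∈ V(s), ∀ y ∈ V(t), ¬ G.Adj x y)

/-- A tubing: a set of pairwise compatible tubes that does not contain all components of `G`. -/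
structure IsTubing (G : Graph α β) (T : Set (Graph α β)) : Prop where
  tube : ∀ t ∈ T, IsTube G t
  compatible : T.Pairwise (TubesCompatible G)
  not_components : ¬ components G ⊆ T

/-- A tubing that is maximal under inclusion. -/
def IsMaximalTubing (G : Graph α β) (T : Set (Graph α β)) : Prop :=
  Maximal (IsTubing G) T

/-- The number of redundant edges: the least number of edges whose removal leaves a simple
graph. -/
noncomputable def redundantEdges (G : Graph α β) : ℕ :=
  sInf {m | ∃ F ⊆ E(G), (G.deleteEdges F).Simple ∧ F.ncard = m}

end Tubes

/-! ### The integer point attached to a maximal tubing -/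

section Coordinates

variable {α β : Type*}

/-- The bundles of `G`: for each pair of adjacent nodes, the set of all edges joining them. -/
def bundles (G : Graph α β) : Set (Set β) :=
  {B | ∃ x y, G.Adj x y ∧ B = {e | G.IsLink e x y}}

/-- `|G|`, the number of nodes and edges of `G`. -/
noncomputable def size (G : Graph α β) : ℕ := V(G).ncard + E(G).ncard

/-- `|G - t|`, the number of nodes and edges of `G` that are not in `t`. -/
noncomputable def cosize (G t : Graph α β) : ℕ := (V(G) \ V(t)).ncard + (E(G) \ E(t)).ncard

/-- The constant `c = |G|²`. -/
noncomputable def base (G : Graph α β) : ℤ := (size G : ℤ) ^ 2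

/-- The prescribed coordinate sum
`c ^ |V(t)| + ∑ᵢ c ^ |E(i,t)| + |G - t|²`, where `i` runs over all the bundles of `G`. -/
noncomputable def tubeValue (G t : Graph α β) : ℤ :=
  base G ^ V(t).ncard + ∑ᶠ B ∈ bundles G, base G ^ (B ∩ E(t)).ncard + (cosize G t : ℤ) ^ 2

/-- The sum of the values of `f` at the nodes and edges of the subgraph `t`. -/
noncomputable def sumOver {G : Graph α β} (f : V(G) ⊕ E(G) → ℤ) (t : Graph α β) : ℤ :=
  (∑ᶠ (x : V(G)) (_ : x.1 ∈ V(t)), f (Sum.inl x)) +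
    ∑ᶠ (y : E(G)) (_ : y.1 ∈ E(t)), f (Sum.inr y)

/-- The number of tubes of `T` that do not contain the edge `y`. -/
noncomputable def missingTubes (T : Set (Graph α β)) (y : β) : ℕ := {t ∈ T | y ∉ E(t)}.ncard

/-- The defining property of the values of `f_T` on the bundle `B`. The edges of `B`, ordered by
the number of tubes of `T` that do not contain them, are `o 0, …, o b`, and `K j` is the largest
tube of `T` that contains `o j` but not `o (j + 1)`. -/
def IsBundleFunction (G : Graph α β) (T : Set (Graph α β)) (f : V(G) ⊕ E(G) → ℤ)
    (B : Set β) : Prop :=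
  ∃ (b : ℕ) (o : Fin (b + 1) → E(G)) (K : Fin b → Graph α β),
    Set.range (fun j => (o j).1) = B ∧
    StrictMono (fun j => missingTubes T (o j).1) ∧
    (∀ j : Fin b, IsGreatest
      {t | t ∈ T ∧ (o j.castSucc).1 ∈ E(t) ∧ (o j.succ).1 ∉ E(t)} (K j)) ∧
    f (Sum.inr (o 0)) = base G + ∑ j : Fin b, (2 * (cosize G (K j) : ℤ) - 1) ∧
    ∀ j : Fin b, f (Sum.inr (o j.succ)) =
      base G ^ (j.val + 1) * (base G - 1) - (2 * (cosize G (K j) : ℤ) - 1)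

/-- `f` is the function `f_T` attached to the maximal tubing `T`: it has the prescribed values on
the edges, and its sum over each tube of `T`, and over `G` itself, is the prescribed one. -/
structure IsVertexFunction (G : Graph α β) (T : Set (Graph α β)) (f : V(G) ⊕ E(G) → ℤ) :
    Prop where
  bundle : ∀ B ∈ bundles G, IsBundleFunction G T f B
  tube : ∀ t ∈ T, sumOver f t = tubeValue G t
  whole : sumOver f G = tubeValue G G

/-- The point `(f(v₁), …, f(vₙ), f(e₁), …, f(eₖ))` of `ℝⁿ⁺ᵏ`. -/
noncomputable def point {G : Graph α β} {n k : ℕ} (v : Fin n ≃ V(G)) (e : Fin k ≃ E(G))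
    (f : V(G) ⊕ E(G) → ℤ) : Fin (n + k) → ℝ :=
  Fin.append (fun i => (f (Sum.inl (v i)) : ℝ)) (fun j => (f (Sum.inr (e j)) : ℝ))

/-- The points attached to the maximal tubings that contain `T`. -/
def points {G : Graph α β} {n k : ℕ} (v : Fin n ≃ V(G)) (e : Fin k ≃ E(G))
    (T : Set (Graph α β)) : Set (Fin (n + k) → ℝ) :=
  {p | ∃ T' f, IsMaximalTubing G T' ∧ T ⊆ T' ∧ IsVertexFunction G T' f ∧ p = point v e f}

/-- The convex hull of the points attached to all the maximal tubings. -/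
def hull {G : Graph α β} {n k : ℕ} (v : Fin n ≃ V(G)) (e : Fin k ≃ E(G)) :
    Set (Fin (n + k) → ℝ) :=
  convexHull ℝ (points v e ∅)

end Coordinates

/-! ### Polytopes -/

section Polytopes

variable {W : Type*} [AddCommGroup W] [Module ℝ W]

/-- A convex polytope: the convex hull of a finite set. -/
def IsPolytope (P : Set W) : Prop := ∃ S : Set W, S.Finite ∧ P = convexHull ℝ S

/-- The dimension of the affine span of a set. -/
noncomputable def dim (P : Set W) : ℕ := Module.finrank ℝ (vectorSpan ℝ P)

variable [TopologicalSpace W]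

/-- The poset of nonempty faces of `P` (including `P` itself), ordered by inclusion. -/
abbrev Face (P : Set W) : Type _ := {F : Set W // IsExposed ℝ P F ∧ F.Nonempty}

/-- `P` is simple: every vertex lies in exactly `dim P` facets. -/
def IsSimplePolytope (P : Set W) : Prop :=
  ∀ x ∈ P.extremePoints ℝ,
    {F : Set W | IsExposed ℝ P F ∧ F.Nonempty ∧ dim F + 1 = dim P ∧ x ∈ F}.ncard = dim P

/-- `P` realizes the pseudograph associahedron of `G` (without loops) through `φ`: it is a simple
convex polytope of dimension `n - 1 + r`, where `n` is the number of nodes and `r` the number of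
redundant edges of `G`, and `φ` is an isomorphism from the poset of tubings of `G`, ordered by
reverse inclusion, onto its face poset, which takes tubings with `m` tubes to faces of
codimension `m`. -/
structure IsAssociahedron {α β : Type*} (G : Graph α β) (P : Set W)
    (φ : {T : Set (Graph α β) // IsTubing G T}ᵒᵈ ≃o Face P) : Prop where
  polytope : IsPolytope P
  simple : IsSimplePolytope P
  dim_eq : dim P + 1 = V(G).ncard + redundantEdges G
  codim : ∀ T : {T : Set (Graph α β) // IsTubing G T},
    dim (φ (OrderDual.toDual T)).1 + T.1.ncard = dim P

end Polytopes

end PseudographAssociahedron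

/-! Call the sum of `f_T` over a subgraph `t` minus Λ(t) the excess at `t`. It vanishes at `G` and
at the tubes of `T`, and the heart of the proof is that it is strictly positive at every other tube
(`IsVertexFunction.excess_pos`). So every tube gives a valid inequality for the polytope, tight
exactly at the points of the maximal tubings that contain the tube.

The combinatorial input is that each member τ of `T ∪ {G}`, for `T` maximal, has exactly one
essential new element: a node of τ in no smaller tube, or an edge of τ in no smaller tube that has a
parallel edge in τ. Existence is `IsTubing.exists_main`; uniqueness holds because removing such an
element leaves tubes that can be added to the tubing. The elements that occur are all the nodes and,
in each bundle, all the edges but the first. Hence |T| + 1 = n + r, the equations for `f_T` are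
triangular, and a vector is determined by its sums over the tubes of `T`, over `G` and over the
bundles. When `t` is removed from `T`, the tube just above it has two such elements; taking them
away in the other order gives the tube that replaces `t` (`IsMaximalTubing.exists_flip`).

Positivity rests on two scales. The powers of `c` make the value at a new node exceed all that
smaller node sets contribute, and make later edges of a bundle much heavier than the first. Where
the powers of `c` tie, the square |G - t|² decides: a later edge with smallest tube τ carries the
correction 2|G - τ| + 1, which is the increment of the square at τ, and this increment strictly
decreases as the subgraph grows.

The rest is convex geometry (`ExchangeSystem`). At the point of `T`, the differences to the
exchanged points are, up to positive factors, dual to the functionals of the tubes of `T`. They form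
a basis of the directions of the polytope, and a functional maximal at this point attains its
maximum on the face of those tubes whose exchange strictly decreases it. This gives the faces, their
dimensions and simplicity. -/

namespace PseudographAssociahedron

open scoped Graph
open Relation

set_option linter.unusedSectionVars false

/-! ### Subgraphs, parallel edges and reachable sets -/

section Subgraphs

variable {α β : Type*} {G H K s t u τ : Graph α β} {x y z w : α} {e e' : β}
  {T : Set (Graph α β)}

/-- Two edges are parallel if they join the same pair of nodes. -/
def Parallel (G : Graph α β) (e e' : β) : Prop := ∃ x y, G.IsLink e x y ∧ G.IsLink e' x y

lemma Parallel.symm (h : Parallel G e e') : Parallel G e' e := by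
  obtain ⟨x, y, h, h'⟩ := h
  exact ⟨x, y, h', h⟩

lemma parallel_self (he : e ∈ E(G)) : Parallel G e e := by
  obtain ⟨x, y, h⟩ := Graph.exists_isLink_of_mem_edgeSet he
  exact ⟨x, y, h, h⟩

lemma Parallel.isLink (h : Parallel G e e') (hxy : G.IsLink e x y) : G.IsLink e' x y := by
  obtain ⟨a, b, h₁, h₂⟩ := h
  obtain ⟨rfl, rfl⟩ | ⟨rfl, rfl⟩ := h₁.eq_and_eq_or_eq_and_eq hxy
  · exact h₂
  · exact h₂.symm

lemma Parallel.trans {e'' : β} (h : Parallel G e e') (h' : Parallel G e' e'') :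
    Parallel G e e'' := by
  obtain ⟨x, y, h₁, h₂⟩ := h
  exact ⟨x, y, h₁, h'.isLink h₂⟩

lemma Parallel.mem_left (h : Parallel G e e') : e ∈ E(G) := by
  obtain ⟨x, y, h₁, h₂⟩ := h
  exact h₁.edge_mem

lemma Parallel.mem_right (h : Parallel G e e') : e' ∈ E(G) := h.symm.mem_left

lemma le_of_subset (hs : s ≤ G) (ht : t ≤ G) (hV : V(s) ⊆ V(t)) (hE : E(s) ⊆ E(t)) : s ≤ t :=
  (Graph.Compatible.of_le_le hs ht).le_iff.2 ⟨hV, hE⟩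

lemma eq_of_sets_eq (hs : s ≤ G) (ht : t ≤ G) (hV : V(s) = V(t)) (hE : E(s) = E(t)) : s = t :=
  (Graph.Compatible.of_le_le hs ht).ext hV hE

/-- A subgraph is full if any two of its nodes that are adjacent in `G` are adjacent in it. -/
structure IsFull (G t : Graph α β) : Prop where
  le : t ≤ G
  adj : ∀ x ∈ V(t), ∀ y ∈ V(t), G.Adj x y → t.Adj x y

lemma isFull_self (G : Graph α β) : IsFull G G := ⟨le_rfl, fun _ _ _ _ h => h⟩

lemma IsTube.isFull (h : IsTube G t) : IsFull G t := ⟨h.le, h.adj⟩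

lemma IsTube.lt (h : IsTube G t) : t < G := lt_of_le_of_ne h.le h.ne

/-- A full subgraph contains an edge parallel to any given edge between its nodes. -/
lemma IsFull.exists_parallel (h : IsFull G t) (he : G.IsLink e x y) (hx : x ∈ V(t))
    (hy : y ∈ V(t)) : ∃ e' ∈ E(t), Parallel G e e' ∧ t.IsLink e' x y := by
  obtain ⟨e', he'⟩ := h.adj x hx y hy ⟨e, he⟩
  exact ⟨e', he'.edge_mem, ⟨x, y, he, he'.mono h.le⟩, he'⟩

lemma isLink_of_le (h : t ≤ G) (he : e ∈ E(t)) (hl : G.IsLink e x y) : t.IsLink e x y :=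
  (h.isLink_iff he).2 hl

/-- Removing an edge that has a parallel edge does not change adjacency. -/
lemma deleteEdges_adj_iff (h : τ ≤ G) (hp : Parallel G e e') (hne : e' ≠ e) (he' : e' ∈ E(τ)) :
    (τ.deleteEdges {e}).Adj x y ↔ τ.Adj x y := by
  constructor
  · exact fun ha => ha.mono Graph.deleteEdges_le
  · rintro ⟨f, hf⟩
    by_cases hfe : f = e
    · subst hfe
      exact ⟨e', by simpa using ⟨isLink_of_le h he' (hp.isLink (hf.mono h)), hne⟩⟩
    · exact ⟨f, by simpa using ⟨hf, hfe⟩⟩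

lemma IsConnected.deleteEdges (hc : IsConnected τ) (h : τ ≤ G) (hp : Parallel G e e')
    (hne : e' ≠ e) (he' : e' ∈ E(τ)) : IsConnected (τ.deleteEdges {e}) := by
  refine ⟨by simpa using hc.1, fun x hx y hy => ?_⟩
  have := hc.2 x (by simpa using hx) y (by simpa using hy)
  exact ReflTransGen.mono (fun a b hab => (deleteEdges_adj_iff h hp hne he').2 hab) _ _ this

lemma IsFull.deleteEdges (hc : IsFull G τ) (hp : Parallel G e e')
    (hne : e' ≠ e) (he' : e' ∈ E(τ)) : IsFull G (τ.deleteEdges {e}) :=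
  ⟨Graph.deleteEdges_le.trans hc.le, fun x hx y hy h =>
    (deleteEdges_adj_iff hc.le hp hne he').2 (hc.adj x (by simpa using hx) y (by simpa using hy) h)⟩

lemma deleteEdges_lt (he : e ∈ E(τ)) : τ.deleteEdges {e} < τ := by
  refine lt_of_le_of_ne Graph.deleteEdges_le fun h => ?_
  have h' : e ∈ E(τ.deleteEdges {e}) := by rw [h]; exact he
  simp at h'

lemma le_deleteEdges (hu : u ≤ τ) (he : e ∉ E(u)) : u ≤ τ.deleteEdges {e} := by
  refine le_of_subset hu Graph.deleteEdges_le ?_ ?_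
  · simpa using hu.vertexSet_mono
  · intro f hf
    simp only [Graph.edgeSet_deleteEdges]
    exact ⟨hu.edgeSet_mono hf, fun h => he (h ▸ hf)⟩

/-- The connected component of the node `x` in `H`. -/
def componentOf (H : Graph α β) (x : α) : Graph α β :=
  H.induce {y | ReflTransGen H.Adj x y}

lemma mem_componentOf : y ∈ V(componentOf H x) ↔ ReflTransGen H.Adj x y := Iff.rfl

lemma self_mem_componentOf : x ∈ V(componentOf H x) := ReflTransGen.refl

lemma componentOf_isLink (hy : y ∈ V(componentOf H x)) (h : H.IsLink e y z) :
    (componentOf H x).IsLink e y z := by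
  refine ⟨h, hy, ?_⟩
  exact ReflTransGen.tail (mem_componentOf.1 hy) ⟨e, h⟩

lemma componentOf_le (hx : x ∈ V(H)) : componentOf H x ≤ H := by
  refine Graph.induce_le fun y hy => ?_
  induction (hy : ReflTransGen H.Adj x y) with
  | refl => exact hx
  | tail _ h _ => exact h.right_mem

lemma reflTransGen_adj_symm (h : ReflTransGen H.Adj x y) : ReflTransGen H.Adj y x := by
  induction h with
  | refl => exact .refl
  | tail _ h ih => exact .head h.symm ih

lemma isConnected_componentOf : IsConnected (componentOf H x) := by
  have key : ∀ y, ReflTransGen H.Adj x y → ReflTransGen (componentOf H x).Adj x y := by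
    intro y hy
    induction hy with
    | refl => exact .refl
    | tail h₁ h ih =>
      obtain ⟨f, hf⟩ := h
      exact ih.tail ⟨f, componentOf_isLink (mem_componentOf.2 h₁) hf⟩
  exact ⟨⟨x, self_mem_componentOf⟩, fun y hy z hz =>
    (reflTransGen_adj_symm (key y hy)).trans (key z hz)⟩

lemma le_componentOf (hx : x ∈ V(H)) (hK : K ≤ H) (hc : IsConnected K) (hy : y ∈ V(K))
    (hy' : y ∈ V(componentOf H x)) : K ≤ componentOf H x := by
  have hV : V(K) ⊆ V(componentOf H x) := fun z hz =>
    (mem_componentOf.1 hy').trans (ReflTransGen.mono (fun a b h => h.mono hK) _ _ (hc.2 y hy z hz))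
  refine le_of_subset hK (componentOf_le hx) hV fun f hf => ?_
  obtain ⟨a, b, hab⟩ := Graph.exists_isLink_of_mem_edgeSet hf
  exact (componentOf_isLink (hV hab.left_mem) (hab.mono hK)).edge_mem

lemma componentOf_mem_components (hx : x ∈ V(H)) : componentOf H x ∈ components H := by
  refine ⟨⟨componentOf_le hx, isConnected_componentOf⟩, fun K hK hle => ?_⟩
  exact le_componentOf hx hK.1 hK.2 (hle.vertexSet_mono self_mem_componentOf) self_mem_componentOf

/-- A connected subgraph that leaves a set of nodes contains an edge leaving that set. -/
lemma IsConnected.exists_adj_of_not_subset {U : Set α} (hc : IsConnected t) (hx : x ∈ V(t))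
    (hxU : x ∈ U) (h : ¬ V(t) ⊆ U) : ∃ y z, t.Adj y z ∧ y ∈ U ∧ z ∉ U := by
  obtain ⟨z, hz, hzU⟩ := Set.not_subset.1 h
  have hr := hc.2 x hx z hz
  by_contra! hcon
  have : ∀ y, ReflTransGen t.Adj x y → y ∈ U := by
    intro y hy
    induction hy with
    | refl => exact hxU
    | tail _ h ih => exact hcon _ _ h ih
  exact hzU (this z hr)

end Subgraphs

/-! ### The combinatorics of tubings -/

section Tubings

variable {α β : Type*} {G H K s t u τ σ : Graph α β} {x y z w : α} {e e' : β}
  {T : Set (Graph α β)}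

lemma TubesCompatible.symm (h : TubesCompatible G s t) : TubesCompatible G t s := by
  rcases h with h | h | ⟨h, h'⟩
  · exact .inr (.inl h)
  · exact .inl h
  · exact .inr (.inr ⟨h.symm, fun x hx y hy hxy => h' y hy x hx hxy.symm⟩)

lemma IsTubing.subset {S : Set (Graph α β)} (hT : IsTubing G T) (h : S ⊆ T) : IsTubing G S :=
  ⟨fun t ht => hT.tube t (h ht), hT.compatible.mono h, fun hc => hT.not_components (hc.trans h)⟩

lemma IsTubing.isFull (hT : IsTubing G T) (hτ : τ ∈ insert G T) : IsFull G τ := by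
  rcases hτ with rfl | hτ
  · exact isFull_self _
  · exact (hT.tube τ hτ).isFull

lemma IsTubing.le (hT : IsTubing G T) (hτ : τ ∈ insert G T) : τ ≤ G := (hT.isFull hτ).le

/-- Two tubes of a tubing that have a common node are comparable. -/
lemma IsTubing.nested (hT : IsTubing G T) (hs : s ∈ insert G T) (ht : t ∈ insert G T)
    (hxs : x ∈ V(s)) (hxt : x ∈ V(t)) : s ≤ t ∨ t ≤ s := by
  by_cases hst : s = t
  · exact .inl hst.le
  rcases hs with rfl | hs
  · exact .inr (hT.le ht)
  rcases ht with rfl | ht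
  · exact .inl (hT.tube s hs).le
  rcases hT.compatible hs ht hst with h | h | ⟨h, -⟩
  · exact .inl h.le
  · exact .inr h.le
  · exact (Set.disjoint_left.1 h hxs hxt).elim

/-- Two tubes of a tubing that are joined by an edge are comparable. -/
lemma IsTubing.nested_of_adj (hT : IsTubing G T) (hs : s ∈ insert G T) (ht : t ∈ insert G T)
    (hxs : x ∈ V(s)) (hyt : y ∈ V(t)) (hxy : G.Adj x y) : s ≤ t ∨ t ≤ s := by
  by_cases hst : s = t
  · exact .inl hst.le
  rcases hs with rfl | hs
  · exact .inr (hT.le ht)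
  rcases ht with rfl | ht
  · exact .inl (hT.tube s hs).le
  rcases hT.compatible hs ht hst with h | h | ⟨-, h⟩
  · exact .inl h.le
  · exact .inr h.le
  · exact (h x hxs y hyt hxy).elim

/-- The node `w` lies in `τ` but in no smaller tube of `T`. -/
structure NewNode (T : Set (Graph α β)) (τ : Graph α β) (w : α) : Prop where
  mem : w ∈ V(τ)
  new : ∀ u ∈ T, u < τ → w ∉ V(u)

/-- The edge `e` lies in `τ` but in no smaller tube of `T`. -/
structure NewEdge (T : Set (Graph α β)) (τ : Graph α β) (e : β) : Prop where
  mem : e ∈ E(τ)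
  new : ∀ u ∈ T, u < τ → e ∉ E(u)

lemma exists_endpoint (he : e ∈ E(G)) : ∃ x, ∀ t ≤ G, e ∈ E(t) → x ∈ V(t) := by
  obtain ⟨x, y, h⟩ := Graph.exists_isLink_of_mem_edgeSet he
  exact ⟨x, fun t ht het => (isLink_of_le ht het h).left_mem⟩

/-- If `w` is new in `τ`, then `τ` is the smallest tube containing `w`. -/
lemma NewNode.le (hT : IsTubing G T) (hτ : τ ∈ insert G T) (h : NewNode T τ w)
    (hs : s ∈ insert G T) (hw : w ∈ V(s)) : τ ≤ s := by
  rcases hT.nested hτ hs h.mem hw with h' | h'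
  · exact h'
  · rcases h'.eq_or_lt with rfl | hlt
    · exact le_rfl
    · rcases hs with rfl | hs
      · exact hT.le hτ
      · exact (h.new s hs hlt hw).elim

lemma NewEdge.le (hT : IsTubing G T) (hτ : τ ∈ insert G T) (h : NewEdge T τ e)
    (hs : s ∈ insert G T) (he : e ∈ E(s)) : τ ≤ s := by
  obtain ⟨x, hx⟩ := exists_endpoint ((hT.le hτ).edgeSet_mono h.mem)
  rcases hT.nested hτ hs (hx τ (hT.le hτ) h.mem) (hx s (hT.le hs) he) with h' | h'
  · exact h'
  · rcases h'.eq_or_lt with rfl | hlt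
    · exact le_rfl
    · rcases hs with rfl | hs
      · exact hT.le hτ
      · exact (h.new s hs hlt he).elim

/-- The alternative in `hG` is resolved only here: an edge is deleted from a tube only if a parallel
edge remains, and then `G` is connected, so that even `G` minus that edge is a tube. -/
lemma isConnected_of_parallel (hG : IsConnected G ∨ G.Simple) (hp : Parallel G e e')
    (hne : e' ≠ e) : IsConnected G := by
  rcases hG with h | h
  · exact h
  · obtain ⟨x, y, h₁, h₂⟩ := hp
    exact (hne (h₂.eq h₁)).elim

lemma eq_of_mem_components (h : s ∈ components G) (hK : K ≤ G) (hc : IsConnected K)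
    (hle : s ≤ K) : s = K :=
  le_antisymm hle ((show Maximal (fun K => K ≤ G ∧ IsConnected K) s from h).2 ⟨hK, hc⟩ hle)

lemma le_of_mem_components (h : s ∈ components G) : s ≤ G :=
  (show Maximal (fun K => K ≤ G ∧ IsConnected K) s from h).1.1

/-- Adding to a tubing a tube that is compatible with it. -/
lemma IsTubing.insert_of (hT : IsTubing G T) (hs : IsTube G s)
    (hc : ∀ u ∈ T, u ≠ s → TubesCompatible G s u) (hcomp : ¬ components G ⊆ insert s T) :
    IsTubing G (insert s T) := by
  refine ⟨?_, ?_, hcomp⟩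
  · rintro t (rfl | ht)
    · exact hs
    · exact hT.tube t ht
  · rintro a (rfl | ha) b (rfl | hb) hab
    · exact (hab rfl).elim
    · exact hc b hb hab.symm
    · exact (hc a ha hab).symm
    · exact hT.compatible ha hb hab

/-- The relation between a tube `u` of a tubing and a subgraph of the tube `τ`. -/
lemma IsTubing.compatible_of_lt (hT : IsTubing G T) (hτ : τ ∈ insert G T) (hs : s < τ)
    (hu : u ∈ T) (h : u < τ → TubesCompatible G s u) : TubesCompatible G s u := by
  by_cases hut : u = τ
  · subst hut
    exact .inl hs
  rcases hτ with rfl | hτ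
  · exact h (hT.tube u hu).lt
  rcases hT.compatible hu hτ hut with h' | h' | ⟨h₁, h₂⟩
  · exact h h'
  · exact .inl (hs.trans h')
  · exact .inr (.inr ⟨(h₁.mono_right hs.le.vertexSet_mono).symm,
      fun x hx y hy hxy => h₂ y hy x (hs.le.vertexSet_mono hx) hxy.symm⟩)

/-- Removing from a tube a new edge that has a parallel edge gives a tube that can be added. -/
lemma IsTubing.insert_deleteEdges (hG : IsConnected G ∨ G.Simple) (hT : IsTubing G T)
    (hτ : τ ∈ insert G T) (he : NewEdge T τ e) (hp : Parallel G e e') (hne : e' ≠ e)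
    (he' : e' ∈ E(τ)) : IsTubing G (insert (τ.deleteEdges {e}) T) := by
  have hGc := isConnected_of_parallel hG hp hne
  have hτc : IsConnected τ := by
    rcases hτ with rfl | hτ
    · exact hGc
    · exact (hT.tube τ hτ).connected
  have hfull := (hT.isFull hτ).deleteEdges hp hne he'
  have hlt := deleteEdges_lt he.mem
  have hneG : τ.deleteEdges {e} ≠ G := (hlt.trans_le (hT.le hτ)).ne
  refine hT.insert_of ⟨hfull.le, hneG, hτc.deleteEdges (hT.le hτ) hp hne he', hfull.adj⟩ ?_ ?_
  · intro u hu hus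
    refine hT.compatible_of_lt hτ hlt hu fun hut => ?_
    exact .inr (.inl (lt_of_le_of_ne (le_deleteEdges hut.le (he.new u hu hut)) hus))
  -- A connected `G` is its own only component, and it is neither a tube nor the added subgraph.
  · intro hcomp
    obtain ⟨x, hx⟩ := hGc.1
    have hmem := componentOf_mem_components hx
    have h₁ := hcomp hmem
    rw [eq_of_mem_components hmem le_rfl hGc (le_of_mem_components hmem)] at h₁
    rcases h₁ with h₁ | h₁
    · exact hneG h₁.symm
    · exact (hT.tube G h₁).ne rfl

/-- The component of `x` in `τ` minus the node `w`. -/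
def cut (τ : Graph α β) (w x : α) : Graph α β := componentOf (τ.deleteVerts {w}) x

lemma mem_deleteVerts (hx : x ∈ V(τ)) (hxw : x ≠ w) : x ∈ V(τ.deleteVerts {w}) := by
  simpa using ⟨hx, hxw⟩

lemma cut_le (hx : x ∈ V(τ)) (hxw : x ≠ w) : cut τ w x ≤ τ.deleteVerts {w} :=
  componentOf_le (mem_deleteVerts hx hxw)

lemma self_mem_cut : x ∈ V(cut τ w x) := self_mem_componentOf

lemma notMem_cut (hx : x ∈ V(τ)) (hxw : x ≠ w) : w ∉ V(cut τ w x) := fun h => by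
  have := (cut_le hx hxw).vertexSet_mono h
  simp at this

lemma cut_lt (hx : x ∈ V(τ)) (hxw : x ≠ w) (hw : w ∈ V(τ)) : cut τ w x < τ := by
  refine lt_of_le_of_ne ((cut_le hx hxw).trans Graph.deleteVerts_le) fun h => ?_
  exact notMem_cut hx hxw (by rw [h]; exact hw)

lemma cut_isLink (hx : x ∈ V(τ)) (hxw : x ≠ w) (hy : y ∈ V(cut τ w x)) (hz : z ≠ w)
    (h : τ.IsLink e y z) : (cut τ w x).IsLink e y z := by
  refine componentOf_isLink hy ?_
  simp only [Graph.deleteVerts_isLink]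
  refine ⟨h, ?_, hz⟩
  rintro rfl
  exact notMem_cut hx hxw hy

lemma le_cut (hx : x ∈ V(τ)) (hxw : x ≠ w) (hu : u ≤ τ) (hc : IsConnected u) (hw : w ∉ V(u))
    (hy : y ∈ V(u)) (hy' : y ∈ V(cut τ w x)) : u ≤ cut τ w x := by
  refine le_componentOf (mem_deleteVerts hx hxw) ?_ hc hy hy'
  refine le_of_subset hu Graph.deleteVerts_le ?_ ?_
  · intro z hz
    refine mem_deleteVerts (hu.vertexSet_mono hz) ?_
    rintro rfl
    exact hw hz
  · intro f hf
    obtain ⟨a, b, hab⟩ := Graph.exists_isLink_of_mem_edgeSet hf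
    simp only [Graph.edgeSet_deleteVerts]
    refine ⟨a, b, hab.mono hu, ?_, ?_⟩
    · rintro rfl
      exact hw hab.left_mem
    · rintro rfl
      exact hw hab.right_mem

lemma isTube_cut (hτ : IsFull G τ) (hx : x ∈ V(τ)) (hxw : x ≠ w) (hw : w ∈ V(τ)) :
    IsTube G (cut τ w x) where
  le := (cut_lt hx hxw hw).le.trans hτ.le
  ne := ((cut_lt hx hxw hw).trans_le hτ.le).ne
  connected := isConnected_componentOf
  adj a ha b hb hab := by
    have hle := (cut_lt hx hxw hw).le.vertexSet_mono
    obtain ⟨f, hf⟩ := hτ.adj a (hle ha) b (hle hb) hab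
    refine ⟨f, cut_isLink hx hxw ha ?_ hf⟩
    rintro rfl
    exact notMem_cut hx hxw hb

/-- Every component of a tube minus a new node is a tube that can be added. -/
lemma IsTubing.insert_cut (hT : IsTubing G T) (hτ : τ ∈ insert G T) (hw : NewNode T τ w)
    (hx : x ∈ V(τ)) (hxw : x ≠ w) : IsTubing G (insert (cut τ w x) T) := by
  have hlt := cut_lt hx hxw hw.mem
  have hfull := hT.isFull hτ
  refine hT.insert_of (isTube_cut hfull hx hxw hw.mem) ?_ ?_
  · intro u hu hus
    refine hT.compatible_of_lt hτ hlt hu fun hut => ?_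
    have hwu := hw.new u hu hut
    have huc := (hT.tube u hu).connected
    -- A smaller tube `u` avoids `w`, so it lies in one component of τ minus `w`: it is inside the
    -- added one, or apart from it and not joined to it by an edge.
    by_cases hdis : Disjoint V(cut τ w x) V(u)
    · refine .inr (.inr ⟨hdis, fun a ha b hb hab => ?_⟩)
      obtain ⟨f, hf⟩ := hfull.adj a (hlt.le.vertexSet_mono ha) b (hut.le.vertexSet_mono hb) hab
      refine Set.disjoint_left.1 hdis (cut_isLink hx hxw ha ?_ hf).right_mem hb
      rintro rfl
      exact hwu hb
    · obtain ⟨y, hy, hy'⟩ := Set.not_disjoint_iff.1 hdis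
      exact .inr (.inl (lt_of_le_of_ne (le_cut hx hxw hut.le huc hwu hy' hy) hus))
  -- The component of `w` is not the added tube, which avoids `w`, so it would lie in `T`. It then
  -- contains τ, so the added tube is strictly inside a component and all components would already
  -- lie in `T`.
  · intro hcomp
    have hwG := (hT.le hτ).vertexSet_mono hw.mem
    have hC := componentOf_mem_components hwG
    have hwC : w ∈ V(componentOf G w) := self_mem_componentOf
    rcases hcomp hC with h | h
    · exact notMem_cut hx hxw (h ▸ hwC)
    · have hle := hw.le hT hτ (.inr h) hwC
      refine hT.not_components fun D hD => ?_
      rcases hcomp hD with rfl | hD'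
      · exact ((hlt.trans_le hle).ne (eq_of_mem_components hD (componentOf_le hwG)
          isConnected_componentOf (hlt.le.trans hle))).elim
      · exact hD'

end Tubings

/-! ### Maximal tubings -/

section Finiteness

variable {α β : Type*} {G s t : Graph α β} {T : Set (Graph α β)}

lemma finite_subgraphs (hV : V(G).Finite) (hE : E(G).Finite) : {t : Graph α β | t ≤ G}.Finite := by
  refine Set.Finite.of_finite_image (f := fun t => (V(t), E(t))) ?_ ?_
  · refine ((hV.finite_subsets).prod hE.finite_subsets).subset ?_
    rintro _ ⟨t, ht, rfl⟩
    exact ⟨ht.vertexSet_mono, ht.edgeSet_mono⟩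
  · intro s hs t ht h
    simp only [Prod.mk.injEq] at h
    exact eq_of_sets_eq hs ht h.1 h.2

lemma finite_tubings (hV : V(G).Finite) (hE : E(G).Finite) : {T | IsTubing G T}.Finite :=
  (finite_subgraphs hV hE).finite_subsets.subset fun _ hT _ ht => (hT.tube _ ht).le

lemma IsTubing.finite (hV : V(G).Finite) (hE : E(G).Finite) (hT : IsTubing G T) : T.Finite :=
  (finite_subgraphs hV hE).subset fun _ ht => (hT.tube _ ht).le

lemma IsTubing.exists_maximal (hV : V(G).Finite) (hE : E(G).Finite) (hT : IsTubing G T) :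
    ∃ T', IsMaximalTubing G T' ∧ T ⊆ T' := by
  obtain ⟨T', h, h'⟩ := (finite_tubings hV hE).exists_le_maximal hT
  exact ⟨T', h', h⟩

/-- The number of nodes and edges strictly increases along proper inclusions of subgraphs. -/
lemma size_lt_size (hV : V(G).Finite) (hE : E(G).Finite) (ht : t ≤ G) (h : s < t) :
    size s < size t := by
  have hVt := hV.subset ht.vertexSet_mono
  have hEt := hE.subset ht.edgeSet_mono
  have h₁ := Set.ncard_le_ncard h.le.vertexSet_mono hVt
  have h₂ := Set.ncard_le_ncard h.le.edgeSet_mono hEt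
  rcases Graph.vertexSet_ssubset_or_edgeSet_ssubset_of_lt h with h' | h'
  · have := Set.ncard_lt_ncard h' hVt
    unfold size
    omega
  · have := Set.ncard_lt_ncard h' hEt
    unfold size
    omega

lemma wellFounded_subgraph (hV : V(G).Finite) (hE : E(G).Finite) {P : Graph α β → Prop}
    (h : ∀ t ≤ G, (∀ s < t, P s) → P t) : ∀ t ≤ G, P t := by
  intro t ht
  induction hn : size t using Nat.strong_induction_on generalizing t with
  | _ n ih =>
    subst hn
    exact h t ht fun s hs => ih _ (size_lt_size hV hE ht hs) s (hs.le.trans ht) rfl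

end Finiteness

section Maximal

variable {α β : Type*} {G H K s t u τ σ : Graph α β} {x y z w w' : α} {e e' : β}
  {T : Set (Graph α β)}

lemma isTubing_empty (hV : V(G).Nonempty) : IsTubing G ∅ := by
  obtain ⟨x, hx⟩ := hV
  exact ⟨by simp, by simp, fun h => h (componentOf_mem_components hx)⟩

lemma IsMaximalTubing.mem_of_insert (hT : IsMaximalTubing G T) (h : IsTubing G (insert s T)) :
    s ∈ T :=
  hT.2 h (Set.subset_insert s T) (Set.mem_insert s T)

lemma IsMaximalTubing.deleteEdges_mem (hG : IsConnected G ∨ G.Simple) (hT : IsMaximalTubing G T)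
    (hτ : τ ∈ insert G T) (he : NewEdge T τ e) (hp : Parallel G e e') (hne : e' ≠ e)
    (he' : e' ∈ E(τ)) : τ.deleteEdges {e} ∈ T :=
  hT.mem_of_insert (hT.1.insert_deleteEdges hG hτ he hp hne he')

lemma IsMaximalTubing.cut_mem (hT : IsMaximalTubing G T) (hτ : τ ∈ insert G T)
    (hw : NewNode T τ w) (hx : x ∈ V(τ)) (hxw : x ≠ w) : cut τ w x ∈ T :=
  hT.mem_of_insert (hT.1.insert_cut hτ hw hx hxw)

/-- Otherwise the component of `w'` in τ minus `w` belongs to `T` by maximality and is a smaller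
tube containing `w'`. -/
lemma NewNode.eq (hT : IsMaximalTubing G T) (hτ : τ ∈ insert G T) (hw : NewNode T τ w)
    (hw' : NewNode T τ w') : w = w' := by
  by_contra hne
  exact hw'.new _ (hT.cut_mem hτ hw hw'.mem (Ne.symm hne))
    (cut_lt hw'.mem (Ne.symm hne) hw.mem) self_mem_cut

/-- By maximality τ minus `e` belongs to `T`, and it contains every other edge of τ and, for
`NewEdge.not_newNode`, every node. -/
lemma NewEdge.eq (hG : IsConnected G ∨ G.Simple) (hT : IsMaximalTubing G T)
    (hτ : τ ∈ insert G T) (he : NewEdge T τ e) (hp : Parallel G e e') (hne : e' ≠ e)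
    (he' : e' ∈ E(τ)) {f : β} (hf : NewEdge T τ f) : f = e := by
  by_contra h
  refine hf.new _ (hT.deleteEdges_mem hG hτ he hp hne he') (deleteEdges_lt he.mem) ?_
  simpa using ⟨hf.mem, h⟩

lemma NewEdge.not_newNode (hG : IsConnected G ∨ G.Simple) (hT : IsMaximalTubing G T)
    (hτ : τ ∈ insert G T) (he : NewEdge T τ e) (hp : Parallel G e e') (hne : e' ≠ e)
    (he' : e' ∈ E(τ)) : ¬ NewNode T τ w := fun h => by
  refine h.new _ (hT.deleteEdges_mem hG hτ he hp hne he') (deleteEdges_lt he.mem) ?_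
  simpa using h.mem

/-- Every node is new in exactly one member of `insert G T`. -/
lemma IsTubing.exists_newNode (hV : V(G).Finite) (hE : E(G).Finite) (hT : IsTubing G T)
    (hw : w ∈ V(G)) : ∃ τ ∈ insert G T, NewNode T τ w := by
  have hfin : {t | t ∈ insert G T ∧ w ∈ V(t)}.Finite :=
    (finite_subgraphs hV hE).subset fun t ht => hT.le ht.1
  obtain ⟨τ, hτ⟩ := hfin.exists_minimal ⟨G, Set.mem_insert _ _, hw⟩
  exact ⟨τ, hτ.1.1, hτ.1.2, fun u hu hlt hwu =>
    hlt.not_ge (hτ.2 ⟨.inr hu, hwu⟩ hlt.le)⟩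

lemma IsTubing.exists_newEdge (hV : V(G).Finite) (hE : E(G).Finite) (hT : IsTubing G T)
    (he : e ∈ E(G)) : ∃ τ ∈ insert G T, NewEdge T τ e := by
  have hfin : {t | t ∈ insert G T ∧ e ∈ E(t)}.Finite :=
    (finite_subgraphs hV hE).subset fun t ht => hT.le ht.1
  obtain ⟨τ, hτ⟩ := hfin.exists_minimal ⟨G, Set.mem_insert _ _, he⟩
  exact ⟨τ, hτ.1.1, hτ.1.2, fun u hu hlt hwu =>
    hlt.not_ge (hτ.2 ⟨.inr hu, hwu⟩ hlt.le)⟩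

/-- A connected subgraph of `τ` that lies in no smaller tube contains a new node of `τ` or a new
edge of `τ` with a parallel edge in `τ`. -/
lemma IsTubing.exists_new (hV : V(G).Finite) (hE : E(G).Finite) (hT : IsTubing G T)
    (hτ : τ ∈ insert G T) (ht : t ≤ τ) (hc : IsConnected t)
    (hmin : ∀ u ∈ T, u < τ → ¬ t ≤ u) :
    (∃ w ∈ V(t), NewNode T τ w) ∨
      ∃ e ∈ E(t), NewEdge T τ e ∧ ∃ e' ∈ E(τ), e' ≠ e ∧ Parallel G e e' := by
  by_cases hnew : ∃ w ∈ V(t), NewNode T τ w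
  · exact .inl hnew
  refine .inr ?_
  have hcov : ∀ w ∈ V(t), ∃ u ∈ T, u < τ ∧ w ∈ V(u) := by
    intro w hw
    by_contra! hcon
    exact hnew ⟨w, hw, ht.vertexSet_mono hw, hcon⟩
  obtain ⟨x, hx⟩ := hc.1
  -- If smaller tubes cover the nodes of `t`, then a maximal one through `x` already covers them
  -- all: an edge of `t` leaving it would lead to a second tube, comparable to it because of that
  -- edge.
  have hfin : {u | u ∈ T ∧ u < τ ∧ x ∈ V(u)}.Finite :=
    (finite_subgraphs hV hE).subset fun u hu => (hT.tube u hu.1).le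
  obtain ⟨u₀, h₀⟩ := hcov x hx
  obtain ⟨u, hu⟩ := hfin.exists_maximal ⟨u₀, h₀⟩
  obtain ⟨⟨huT, huτ, hxu⟩, humax⟩ := hu
  have humax' : ∀ v ∈ T, v < τ → u ≤ v → v ≤ u := fun v hv hvτ huv =>
    humax ⟨hv, hvτ, huv.vertexSet_mono hxu⟩ huv
  have hVtu : V(t) ⊆ V(u) := by
    by_contra hcon
    obtain ⟨y, z, hyz, hy, hz⟩ := hc.exists_adj_of_not_subset hx hxu hcon
    obtain ⟨v, hv, hvτ, hzv⟩ := hcov z hyz.right_mem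
    have hadj := hyz.mono (ht.trans (hT.le hτ))
    rcases hT.nested_of_adj (.inr huT) (.inr hv) hy hzv hadj with h | h
    · exact hz ((humax' v hv hvτ h).vertexSet_mono hzv)
    · exact hz (h.vertexSet_mono hzv)
  -- Thus `t` exceeds `u` by an edge only. That edge is new, since a smaller tube containing it
  -- would lie in `u`, and `u`, being full, contains a parallel edge.
  have hEtu : ¬ E(t) ⊆ E(u) := fun h =>
    hmin u huT huτ (le_of_subset ht huτ.le hVtu h)
  obtain ⟨e, het, heu⟩ := Set.not_subset.1 hEtu
  obtain ⟨a, b, hab⟩ := Graph.exists_isLink_of_mem_edgeSet het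
  have habG := hab.mono (ht.trans (hT.le hτ))
  refine ⟨e, het, ⟨ht.edgeSet_mono het, fun v hv hvτ hev => ?_⟩, ?_⟩
  · have hav := (isLink_of_le (hT.le (.inr hv)) hev habG).left_mem
    rcases hT.nested (.inr huT) (.inr hv) (hVtu hab.left_mem) hav with h | h
    · exact heu ((humax' v hv hvτ h).edgeSet_mono hev)
    · exact heu (h.edgeSet_mono hev)
  · obtain ⟨e', he'u, hp, -⟩ := (hT.isFull (.inr huT)).exists_parallel habG (hVtu hab.left_mem)
      (hVtu hab.right_mem)
    exact ⟨e', huτ.le.edgeSet_mono he'u, fun h => heu (h ▸ he'u), hp⟩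

/-- Every member of `insert G T` has a new node, or a new edge with a parallel edge. -/
lemma IsTubing.exists_main (hV : V(G).Finite) (hE : E(G).Finite) (hT : IsTubing G T)
    (hτ : τ ∈ insert G T) :
    (∃ w, NewNode T τ w) ∨
      ∃ e, NewEdge T τ e ∧ ∃ e' ∈ E(τ), e' ≠ e ∧ Parallel G e e' := by
  -- `G` need not be connected, so for τ = `G` a component outside `T` takes the place of τ.
  have key : ∃ t ≤ τ, IsConnected t ∧ ∀ u ∈ T, u < τ → ¬ t ≤ u := by
    by_cases hτT : τ ∈ T
    · exact ⟨τ, le_rfl, (hT.tube τ hτT).connected, fun u _ hlt h => hlt.not_ge h⟩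
    · obtain rfl : τ = G := hτ.resolve_right hτT
      obtain ⟨C, hC, hCT⟩ := Set.not_subset.1 hT.not_components
      refine ⟨C, le_of_mem_components hC,
        (show Maximal (fun K => K ≤ τ ∧ IsConnected K) C from hC).1.2, fun u hu _ h => hCT ?_⟩
      rw [eq_of_mem_components hC (hT.tube u hu).le (hT.tube u hu).connected h]
      exact hu
  obtain ⟨t, ht, hc, hmin⟩ := key
  rcases hT.exists_new hV hE hτ ht hc hmin with ⟨w, -, h⟩ | ⟨e, -, h⟩
  · exact .inl ⟨w, h⟩
  · exact .inr ⟨e, h⟩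

/-- Every tube of a maximal tubing can be exchanged for another one. -/
theorem IsMaximalTubing.exists_flip (hG : IsConnected G ∨ G.Simple) (hV : V(G).Finite)
    (hE : E(G).Finite) (hT : IsMaximalTubing G T) (ht : t ∈ T) :
    ∃ T', IsMaximalTubing G T' ∧ T \ {t} ⊆ T' ∧ t ∉ T' := by
  have hT₀ : IsTubing G (T \ {t}) := hT.1.subset Set.sdiff_subset
  -- A maximal tubing containing `t'` and the rest of `T` cannot contain `t` as well, for it would
  -- then contain `T` properly.
  suffices h : ∃ t', t' ∉ T ∧ IsTubing G (insert t' (T \ {t})) by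
    obtain ⟨t', ht', h'⟩ := h
    obtain ⟨T', hT', hsub⟩ := h'.exists_maximal hV hE
    refine ⟨T', hT', (Set.subset_insert _ _).trans hsub, fun htT' => ht' ?_⟩
    have hle : T ⊆ T' := fun u hu => by
      by_cases hut : u = t
      · exact hut ▸ htT'
      · exact hsub (.inr ⟨hu, hut⟩)
    exact hT.2 hT'.1 hle (hsub (Set.mem_insert _ _))
  have htube := hT.1.tube t ht
  have hfin : {u | u ∈ insert G T ∧ t < u}.Finite :=
    (finite_subgraphs hV hE).subset fun u hu => hT.1.le hu.1
  obtain ⟨τ, ⟨hτ, htτ⟩, hτmin⟩ := hfin.exists_minimal ⟨G, Set.mem_insert _ _, htube.lt⟩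
  have hτ₀ : τ ∈ insert G (T \ {t}) := by
    rcases hτ with rfl | hτ
    · exact Set.mem_insert _ _
    · exact .inr ⟨hτ, htτ.ne'⟩
  -- tubes of `T` that meet `t` and lie strictly below `τ` lie in `t`
  have hbelow : ∀ u ∈ T, u < τ → ∀ x ∈ V(t), x ∈ V(u) → u ≤ t := by
    intro u hu huτ x hxt hxu
    rcases hT.1.nested (.inr hu) (.inr ht) hxu hxt with h | h
    · exact h
    · rcases h.eq_or_lt with rfl | h
      · exact le_rfl
      · exact (huτ.not_ge (hτmin ⟨.inr hu, h⟩ huτ.le)).elim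
  -- Without `t`, what was new in `t` becomes new in the next larger τ, next to the new element of τ
  -- itself. The replacing tube gives up the former and keeps the latter.
  have hnode : ∀ w, NewNode T t w → NewNode (T \ {t}) τ w := by
    intro w hw
    refine ⟨htτ.le.vertexSet_mono hw.mem, fun u hu huτ hwu => ?_⟩
    exact hw.new u hu.1 (lt_of_le_of_ne (hbelow u hu.1 huτ w hw.mem hwu) hu.2) hwu
  have hedge : ∀ e, NewEdge T t e → NewEdge (T \ {t}) τ e := by
    intro e he
    refine ⟨htτ.le.edgeSet_mono he.mem, fun u hu huτ heu => ?_⟩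
    obtain ⟨x, hx⟩ := exists_endpoint (htube.le.edgeSet_mono he.mem)
    exact he.new u hu.1 (lt_of_le_of_ne (hbelow u hu.1 huτ x (hx t htube.le he.mem)
      (hx u (hT.1.le (.inr hu.1)) heu)) hu.2) heu
  have hdel : ∀ e, NewEdge T t e → ∀ e' ∈ E(τ), e' ≠ e → Parallel G e e' →
      τ.deleteEdges {e} ∉ T → ∃ t', t' ∉ T ∧ IsTubing G (insert t' (T \ {t})) :=
    fun e he e' he' hne hp h =>
      ⟨_, h, hT₀.insert_deleteEdges hG hτ₀ (hedge e he) hp hne he'⟩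
  rcases hT.1.exists_main hV hE (.inr ht) with ⟨w, hw⟩ | ⟨e, he, e', he', hne, hp⟩
  · have hcut : ∀ x ∈ V(τ), x ≠ w → cut τ w x ∉ T →
        ∃ t', t' ∉ T ∧ IsTubing G (insert t' (T \ {t})) :=
      fun x hx hxw h => ⟨_, h, hT₀.insert_cut hτ₀ (hnode w hw) hx hxw⟩
    have hwτ := htτ.le.vertexSet_mono hw.mem
    rcases hT.1.exists_main hV hE hτ with ⟨w', hw'⟩ | ⟨e, he, e', he', hne, hp⟩
    · have hww' : w' ≠ w := by
        rintro rfl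
        exact hw'.new t ht htτ hw.mem
      exact hcut w' hw'.mem hww' fun h =>
        hw'.new _ h (cut_lt hw'.mem hww' hwτ) self_mem_cut
    · obtain ⟨a, b, hab⟩ := Graph.exists_isLink_of_mem_edgeSet he.mem
      by_cases hinc : a = w ∨ b = w
      · -- the edge `e` is incident to `w`: exchange it with its parallel edge in `t`
        have hdelT := hT.deleteEdges_mem hG hτ he hp hne he'
        have htle : t ≤ τ.deleteEdges {e} := le_deleteEdges htτ.le (he.new t ht htτ)
        -- Both lie in `T`, and no member of `T` lies strictly between `t` and τ.
        have hteq : τ.deleteEdges {e} = t := by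
          refine le_antisymm (hbelow _ hdelT (deleteEdges_lt he.mem) w hw.mem ?_) htle
          exact htle.vertexSet_mono hw.mem
        have hVt : V(t) = V(τ) := by rw [← hteq]; simp
        have habG := hab.mono (hT.1.le hτ)
        obtain ⟨f, hf, hpf, hfl⟩ := htube.isFull.exists_parallel habG
          (hVt ▸ hab.left_mem) (hVt ▸ hab.right_mem)
        have hef : e ≠ f := by
          rintro rfl
          exact he.new t ht htτ hf
        have hfnew : NewEdge T t f := by
          refine ⟨hf, fun u hu hut hfu => ?_⟩
          have hl := isLink_of_le (hT.1.le (.inr hu)) hfu (hpf.isLink habG)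
          rcases hinc with rfl | rfl
          · exact hw.new u hu hut hl.left_mem
          · exact hw.new u hu hut hl.right_mem
        refine hdel f hfnew e he.mem hef hpf.symm fun h => ?_
        refine he.new _ h (deleteEdges_lt (htτ.le.edgeSet_mono hf)) ?_
        simpa using ⟨he.mem, hef⟩
      · push Not at hinc
        refine hcut a hab.left_mem hinc.1 fun h => ?_
        exact he.new _ h (cut_lt hab.left_mem hinc.1 hwτ)
          (cut_isLink hab.left_mem hinc.1 self_mem_cut hinc.2 hab).edge_mem
  -- Now the new element of `t` is an edge `e`. The graph τ minus `e` still contains the new element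
  -- of τ, so it is not in `T`.
  · refine hdel e he e' (htτ.le.edgeSet_mono he') hne hp fun h => ?_
    have hlt : τ.deleteEdges {e} < τ := deleteEdges_lt (htτ.le.edgeSet_mono he.mem)
    rcases hT.1.exists_main hV hE hτ with ⟨w', hw'⟩ | ⟨f, hf, -⟩
    · exact hw'.new _ h hlt (by simpa using hw'.mem)
    · refine hf.new _ h hlt ?_
      simp only [Graph.edgeSet_deleteEdges]
      refine ⟨hf.mem, ?_⟩
      rintro rfl
      exact hf.new t ht htτ he.mem

end Maximal

/-! ### Finite sums over subgraphs -/

section Sums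

open Classical

variable {α β : Type*} {G s t τ : Graph α β} {T : Set (Graph α β)}
  [Fintype V(G)] [Fintype E(G)]

/-- The nodes of `t`, as a finite set of nodes of `G`. -/
noncomputable def nodes (G t : Graph α β) [Fintype V(G)] : Finset V(G) := {x | x.1 ∈ V(t)}

/-- The edges of `t`, as a finite set of edges of `G`. -/
noncomputable def edges (G t : Graph α β) [Fintype E(G)] : Finset E(G) := {y | y.1 ∈ E(t)}

/-- The edges parallel to `e`. -/
noncomputable def bundleOf (e : E(G)) : Finset E(G) := {y | Parallel G e.1 y.1}

/-- The set of bundles of `G`. -/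
noncomputable def bundleFinset (G : Graph α β) [Fintype E(G)] : Finset (Finset E(G)) :=
  Finset.univ.image bundleOf

@[simp] lemma mem_nodes {x : V(G)} : x ∈ nodes G t ↔ x.1 ∈ V(t) := by simp [nodes]

@[simp] lemma mem_edges {y : E(G)} : y ∈ edges G t ↔ y.1 ∈ E(t) := by simp [edges]

@[simp] lemma mem_bundle {e y : E(G)} : y ∈ bundleOf e ↔ Parallel G e.1 y.1 := by simp [bundleOf]

lemma self_mem_bundle (e : E(G)) : e ∈ bundleOf e := mem_bundle.2 (parallel_self e.2)

lemma bundle_eq {e e' : E(G)} (h : Parallel G e.1 e'.1) : bundleOf e = bundleOf e' := by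
  ext y
  simp only [mem_bundle]
  exact ⟨fun h' => h.symm.trans h', fun h' => h.trans h'⟩

lemma mem_bundle_iff_eq {e y : E(G)} : y ∈ bundleOf e ↔ bundleOf y = bundleOf e := by
  refine ⟨fun h => (bundle_eq (mem_bundle.1 h)).symm, fun h => ?_⟩
  rw [← h]
  exact self_mem_bundle y

lemma bundle_mem (e : E(G)) : bundleOf e ∈ bundleFinset G := Finset.mem_image_of_mem _ (by simp)

lemma sumOver_eq (f : V(G) ⊕ E(G) → ℤ) (t : Graph α β) :
    sumOver f t = ∑ x ∈ nodes G t, f (.inl x) + ∑ y ∈ edges G t, f (.inr y) := by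
  unfold sumOver
  congr 1
  · rw [← finsum_mem_coe_finset]
    simp
  · rw [← finsum_mem_coe_finset]
    simp

lemma ncard_vertexSet (ht : t ≤ G) : V(t).ncard = (nodes G t).card := by
  rw [← Set.ncard_coe_finset, ← Set.ncard_image_of_injective _ Subtype.val_injective]
  congr 1
  ext x
  simpa using fun h => ht.vertexSet_mono h

lemma ncard_edgeSet (ht : t ≤ G) : E(t).ncard = (edges G t).card := by
  rw [← Set.ncard_coe_finset, ← Set.ncard_image_of_injective _ Subtype.val_injective]
  congr 1
  ext x
  simpa using fun h => ht.edgeSet_mono h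

lemma size_eq (ht : t ≤ G) : size t = (nodes G t).card + (edges G t).card := by
  rw [size, ncard_vertexSet ht, ncard_edgeSet ht]

lemma cosize_add (ht : t ≤ G) :
    cosize G t + (nodes G t).card + (edges G t).card = size G := by
  have h₁ := Set.ncard_sdiff_add_ncard_of_subset ht.vertexSet_mono (Set.toFinite V(G))
  have h₂ := Set.ncard_sdiff_add_ncard_of_subset ht.edgeSet_mono (Set.toFinite E(G))
  rw [cosize, size, ← ncard_vertexSet ht, ← ncard_edgeSet ht]
  omega

lemma cosize_lt_cosize (ht : t ≤ G) (h : s < t) : cosize G t < cosize G s := by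
  have h₁ := cosize_add ht
  have h₂ := cosize_add (h.le.trans ht)
  have h₃ := size_lt_size (Set.toFinite V(G)) (Set.toFinite E(G)) ht h
  rw [size_eq ht, size_eq (h.le.trans ht)] at h₃
  omega

lemma bundles_eq : bundles G =
    (fun S : Finset E(G) => Subtype.val '' (S : Set E(G))) '' (bundleFinset G) := by
  have key : ∀ (e : E(G)) x y, G.IsLink e.1 x y →
      Subtype.val '' (bundleOf e : Set E(G)) = {f | G.IsLink f x y} := by
    intro e x y h
    ext f
    simp only [Set.mem_image, Finset.mem_coe, mem_bundle, Subtype.exists, exists_and_right,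
      exists_eq_right, Set.mem_ofPred_eq]
    exact ⟨fun ⟨_, hp⟩ => hp.isLink h, fun h' => ⟨h'.edge_mem, x, y, h, h'⟩⟩
  ext B
  simp only [bundles, Set.mem_ofPred_eq, Set.mem_image, Finset.mem_coe, bundleFinset,
    Finset.mem_image, Finset.mem_univ, true_and, exists_exists_eq_and]
  constructor
  · rintro ⟨x, y, ⟨e, he⟩, rfl⟩
    exact ⟨⟨e, he.edge_mem⟩, key _ x y he⟩
  · rintro ⟨e, rfl⟩
    obtain ⟨x, y, h⟩ := Graph.exists_isLink_of_mem_edgeSet e.2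
    exact ⟨x, y, h.adj, key e x y h⟩

lemma mem_bundles_iff {B : Set β} :
    B ∈ bundles G ↔ ∃ e : E(G), B = Subtype.val '' (bundleOf e : Set E(G)) := by
  simp [bundles_eq, bundleFinset, eq_comm]

lemma tubeValue_eq (ht : t ≤ G) : tubeValue G t = base G ^ (nodes G t).card +
    ∑ B ∈ bundleFinset G, base G ^ (B ∩ edges G t).card + (cosize G t : ℤ) ^ 2 := by
  rw [tubeValue, ncard_vertexSet ht, bundles_eq, finsum_mem_image, finsum_mem_coe_finset]
  · congr 2
    refine Finset.sum_congr rfl fun B _ => ?_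
    congr 1
    rw [← Set.ncard_coe_finset, ← Set.ncard_image_of_injective _ Subtype.val_injective]
    congr 1
    ext x
    simp only [Set.mem_inter_iff, Set.mem_image, Finset.mem_coe, Finset.mem_inter, mem_edges]
    grind
  · intro B _ B' _ h
    exact_mod_cast Set.image_injective.2 Subtype.val_injective h

/-- The difference between the sum of `f` over `t` and its prescribed value. -/
noncomputable def excess (f : V(G) ⊕ E(G) → ℤ) (t : Graph α β) : ℤ := sumOver f t - tubeValue G t

lemma nodes_deleteEdges (t : Graph α β) (F : Set β) : nodes G (t.deleteEdges F) = nodes G t := by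
  ext x; simp

lemma edges_deleteEdges (t : Graph α β) (e : E(G)) :
    edges G (t.deleteEdges {e.1}) = (edges G t).erase e := by
  ext y
  simp [and_comm, Subtype.ext_iff]

lemma cosize_deleteEdges (ht : t ≤ G) {e : E(G)} (he : e.1 ∈ E(t)) :
    cosize G (t.deleteEdges {e.1}) = cosize G t + 1 := by
  have h₁ := cosize_add ht
  have h₂ := cosize_add (Graph.deleteEdges_le.trans ht : t.deleteEdges {e.1} ≤ G)
  rw [nodes_deleteEdges, edges_deleteEdges] at h₂
  have h₃ := Finset.card_erase_add_one (mem_edges.2 he)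
  omega

/-- The change of the excess when an edge is added. -/
lemma excess_deleteEdges (f : V(G) ⊕ E(G) → ℤ) (ht : t ≤ G) {e : E(G)} (he : e.1 ∈ E(t)) {q : ℕ}
    (hq : (bundleOf e ∩ edges G t).card = q + 1) :
    excess f t = excess f (t.deleteEdges {e.1}) + f (.inr e)
      - base G ^ q * (base G - 1) + 2 * cosize G t + 1 := by
  have hle : t.deleteEdges {e.1} ≤ G := Graph.deleteEdges_le.trans ht
  -- Only the bundle of `e` changes, from `q` to `q + 1` edges. The term `2 * cosize G t + 1` of the
  -- statement is the drop of the square from `(cosize G t + 1) ^ 2` to `cosize G t ^ 2`.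
  have hB : ∑ B ∈ bundleFinset G, base G ^ (B ∩ edges G t).card =
      ∑ B ∈ bundleFinset G, base G ^ (B ∩ edges G (t.deleteEdges {e.1})).card +
        base G ^ q * (base G - 1) := by
    rw [← Finset.add_sum_erase _ _ (bundle_mem e), ← Finset.add_sum_erase _ _ (bundle_mem e),
      Finset.sum_congr rfl (g := fun B => base G ^ (B ∩ edges G (t.deleteEdges {e.1})).card), hq]
    · have : (bundleOf e ∩ edges G (t.deleteEdges {e.1})).card = q := by
        rw [edges_deleteEdges, Finset.inter_erase, Finset.card_erase_of_mem, hq]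
        · rfl
        · exact Finset.mem_inter.2 ⟨self_mem_bundle e, mem_edges.2 he⟩
      rw [this]
      ring
    · intro B hB
      congr 2
      rw [edges_deleteEdges, Finset.inter_erase, Finset.erase_eq_of_notMem]
      intro hmem
      obtain ⟨hne, hB⟩ := Finset.mem_erase.1 hB
      obtain ⟨e', -, rfl⟩ := Finset.mem_image.1 hB
      exact hne (mem_bundle_iff_eq.1 (Finset.mem_inter.1 hmem).1).symm
  rw [excess, excess, sumOver_eq, sumOver_eq, tubeValue_eq ht, tubeValue_eq hle, hB,
    cosize_deleteEdges ht he, nodes_deleteEdges, edges_deleteEdges,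
    ← Finset.add_sum_erase _ _ (mem_edges.2 he)]
  push_cast
  ring

lemma excess_eq_zero_iff {f : V(G) ⊕ E(G) → ℤ} : excess f t = 0 ↔ sumOver f t = tubeValue G t :=
  sub_eq_zero

end Sums

/-- A triangular system of equations has exactly one solution. -/
lemma existsUnique_triangular {X M : Type*} [Fintype X] [AddCommGroup M] (r : X → ℕ)
    (S : X → Finset X) (hS : ∀ x, x ∈ S x) (hr : ∀ x, ∀ y ∈ S x, y ≠ x → r y < r x) (D : X → M) :
    ∃! f : X → M, ∀ x, ∑ y ∈ S x, f y = D x := by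
  classical
  have hex : ∀ n, ∃ f : X → M, ∀ x, r x < n → ∑ y ∈ S x, f y = D x := by
    intro n
    induction n with
    | zero => exact ⟨0, by simp⟩
    | succ n ih =>
      obtain ⟨f, hf⟩ := ih
      refine ⟨fun x => if r x < n then f x else D x - ∑ y ∈ (S x).erase x, f y, fun x hx => ?_⟩
      have hsum : ∑ y ∈ (S x).erase x, (if r y < n then f y else D y - ∑ z ∈ (S y).erase y, f z) =
          ∑ y ∈ (S x).erase x, f y := by
        refine Finset.sum_congr rfl fun y hy => ?_
        have := hr x y (Finset.mem_of_mem_erase hy) (Finset.ne_of_mem_erase hy)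
        rw [if_pos (by omega)]
      rw [← Finset.add_sum_erase _ _ (hS x), hsum]
      split_ifs with h
      · rw [Finset.add_sum_erase _ _ (hS x), hf x h]
      · simp
  obtain ⟨f, hf⟩ := hex (Finset.univ.sup r + 1)
  have hf' : ∀ x, ∑ y ∈ S x, f y = D x := fun x =>
    hf x (Nat.lt_succ_of_le (Finset.le_sup (Finset.mem_univ x)))
  refine ⟨f, hf', fun g hg => ?_⟩
  have key : ∀ n, ∀ x, r x < n → g x = f x := by
    intro n
    induction n with
    | zero => simp
    | succ n ih =>
      intro x hx
      have h := (hg x).trans (hf' x).symm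
      rw [← Finset.add_sum_erase _ _ (hS x), ← Finset.add_sum_erase _ f (hS x),
        Finset.sum_congr rfl fun y hy => ih y ?_] at h
      · exact add_right_cancel h
      · have := hr x y (Finset.mem_of_mem_erase hy) (Finset.ne_of_mem_erase hy)
        omega
  funext x
  exact key _ x (Nat.lt_succ_self _)

/-! ### The order of the edges of a bundle -/

section Rank

open Classical

variable {α β : Type*} {G s t τ : Graph α β} {T : Set (Graph α β)}

/-- The smallest member of `insert G T` that contains the edge `e`. -/
noncomputable def edgeTube (G : Graph α β) (T : Set (Graph α β)) (e : β) : Graph α β :=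
  Classical.epsilon fun τ => τ ∈ insert G T ∧ NewEdge T τ e

/-- The smallest member of `insert G T` that contains the node `x`. -/
noncomputable def nodeTube (G : Graph α β) (T : Set (Graph α β)) (x : α) : Graph α β :=
  Classical.epsilon fun τ => τ ∈ insert G T ∧ NewNode T τ x

variable [Fintype V(G)] [Fintype E(G)]

lemma IsTubing.edgeTube_spec (hT : IsTubing G T) (e : E(G)) :
    edgeTube G T e.1 ∈ insert G T ∧ NewEdge T (edgeTube G T e.1) e.1 :=
  Classical.epsilon_spec (hT.exists_newEdge (Set.toFinite _) (Set.toFinite _) e.2)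

lemma IsTubing.nodeTube_spec (hT : IsTubing G T) (x : V(G)) :
    nodeTube G T x.1 ∈ insert G T ∧ NewNode T (nodeTube G T x.1) x.1 :=
  Classical.epsilon_spec (hT.exists_newNode (Set.toFinite _) (Set.toFinite _) x.2)

lemma IsTubing.edgeTube_le_iff (hT : IsTubing G T) (e : E(G)) (hτ : τ ∈ insert G T) :
    edgeTube G T e.1 ≤ τ ↔ e.1 ∈ E(τ) :=
  ⟨fun h => h.edgeSet_mono (hT.edgeTube_spec e).2.mem,
    (hT.edgeTube_spec e).2.le hT (hT.edgeTube_spec e).1 hτ⟩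

lemma IsTubing.nodeTube_le_iff (hT : IsTubing G T) (x : V(G)) (hτ : τ ∈ insert G T) :
    nodeTube G T x.1 ≤ τ ↔ x.1 ∈ V(τ) :=
  ⟨fun h => h.vertexSet_mono (hT.nodeTube_spec x).2.mem,
    (hT.nodeTube_spec x).2.le hT (hT.nodeTube_spec x).1 hτ⟩

lemma IsTubing.edgeTube_eq (hT : IsTubing G T) (e : E(G)) (hτ : τ ∈ insert G T)
    (h : NewEdge T τ e.1) : edgeTube G T e.1 = τ :=
  le_antisymm ((hT.edgeTube_le_iff e hτ).2 h.mem)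
    (h.le hT hτ (hT.edgeTube_spec e).1 (hT.edgeTube_spec e).2.mem)

lemma IsTubing.nodeTube_eq (hT : IsTubing G T) (x : V(G)) (hτ : τ ∈ insert G T)
    (h : NewNode T τ x.1) : nodeTube G T x.1 = τ :=
  le_antisymm ((hT.nodeTube_le_iff x hτ).2 h.mem)
    (h.le hT hτ (hT.nodeTube_spec x).1 (hT.nodeTube_spec x).2.mem)

/-- The position of an edge in its bundle: the number of edges of the bundle in the smallest
tube that contains the edge. -/
noncomputable def edgeRank (T : Set (Graph α β)) (e : E(G)) : ℕ :=
  (bundleOf e ∩ edges G (edgeTube G T e.1)).card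

lemma IsTubing.edgeTube_total (hT : IsTubing G T) {e e' : E(G)} (hp : Parallel G e.1 e'.1) :
    edgeTube G T e.1 ≤ edgeTube G T e'.1 ∨ edgeTube G T e'.1 ≤ edgeTube G T e.1 := by
  obtain ⟨x, y, h, h'⟩ := hp
  have h₁ := hT.edgeTube_spec e
  have h₂ := hT.edgeTube_spec e'
  exact hT.nested h₁.1 h₂.1 (isLink_of_le (hT.le h₁.1) h₁.2.mem h).left_mem
    (isLink_of_le (hT.le h₂.1) h₂.2.mem h').left_mem

/-- Two parallel edges with the same smallest tube would both be new in it, each with the other as a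
parallel edge. -/
lemma IsMaximalTubing.edgeTube_injective (hG : IsConnected G ∨ G.Simple)
    (hT : IsMaximalTubing G T) {e e' : E(G)} (hp : Parallel G e.1 e'.1)
    (h : edgeTube G T e.1 = edgeTube G T e'.1) : e = e' := by
  by_contra hne
  have h₁ := hT.1.edgeTube_spec e
  have h₂ := hT.1.edgeTube_spec e'
  rw [← h] at h₂
  have hne' : e'.1 ≠ e.1 := fun h => hne (Subtype.ext h).symm
  exact hne' (h₁.2.eq hG hT h₁.1 hp hne' h₂.2.mem h₂.2)

lemma edgeRank_lt_of_lt (hT : IsTubing G T) {e e' : E(G)} (hp : Parallel G e.1 e'.1)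
    (h : edgeTube G T e.1 < edgeTube G T e'.1) : edgeRank T e < edgeRank T e' := by
  refine Finset.card_lt_card (Finset.ssubset_iff_of_subset ?_ |>.2 ⟨e', ?_, ?_⟩)
  · rw [bundle_eq hp]
    refine Finset.inter_subset_inter_left fun y hy => ?_
    exact mem_edges.2 (h.le.edgeSet_mono (mem_edges.1 hy))
  · exact Finset.mem_inter.2 ⟨self_mem_bundle e', mem_edges.2 (hT.edgeTube_spec e').2.mem⟩
  · intro hmem
    have := mem_edges.1 (Finset.mem_inter.1 hmem).2
    exact h.not_ge ((hT.edgeTube_le_iff e' (hT.edgeTube_spec e).1).2 this)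

lemma IsMaximalTubing.edgeTube_lt (hG : IsConnected G ∨ G.Simple) (hT : IsMaximalTubing G T)
    {e e' : E(G)} (hp : Parallel G e.1 e'.1) (h : edgeRank T e < edgeRank T e') :
    edgeTube G T e.1 < edgeTube G T e'.1 := by
  rcases hT.1.edgeTube_total hp with h' | h'
  · refine lt_of_le_of_ne h' fun heq => ?_
    obtain rfl := hT.edgeTube_injective hG hp heq
    exact h.ne rfl
  · rcases h'.eq_or_lt with heq | hlt
    · obtain rfl := hT.edgeTube_injective hG hp heq.symm
      exact (h.ne rfl).elim
    · exact (h.not_gt (edgeRank_lt_of_lt hT.1 hp.symm hlt)).elim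

lemma IsMaximalTubing.edgeRank_injective (hG : IsConnected G ∨ G.Simple)
    (hT : IsMaximalTubing G T) {e e' : E(G)} (hp : Parallel G e.1 e'.1)
    (h : edgeRank T e = edgeRank T e') : e = e' := by
  refine hT.edgeTube_injective hG hp ?_
  rcases hT.1.edgeTube_total hp with h' | h'
  · rcases h'.eq_or_lt with heq | hlt
    · exact heq
    · exact ((edgeRank_lt_of_lt hT.1 hp hlt).ne h).elim
  · rcases h'.eq_or_lt with heq | hlt
    · exact heq.symm
    · exact ((edgeRank_lt_of_lt hT.1 hp.symm hlt).ne h.symm).elim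

lemma one_le_edgeRank (hT : IsTubing G T) (e : E(G)) : 1 ≤ edgeRank T e :=
  Finset.card_pos.2 ⟨e, Finset.mem_inter.2
    ⟨self_mem_bundle e, mem_edges.2 (hT.edgeTube_spec e).2.mem⟩⟩

lemma edgeRank_le_card (e : E(G)) : edgeRank T e ≤ (bundleOf e).card :=
  Finset.card_le_card Finset.inter_subset_left

/-- A tube that contains an edge contains all the earlier edges of the bundle. -/
lemma IsMaximalTubing.mem_of_edgeRank_le (hG : IsConnected G ∨ G.Simple)
    (hT : IsMaximalTubing G T) {e e' : E(G)} (hp : Parallel G e.1 e'.1)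
    (h : edgeRank T e ≤ edgeRank T e') (hτ : τ ∈ insert G T) (he' : e'.1 ∈ E(τ)) :
    e.1 ∈ E(τ) := by
  rcases h.eq_or_lt with h | h
  · obtain rfl := hT.edgeRank_injective hG hp h
    exact he'
  · rw [← hT.1.edgeTube_le_iff e hτ]
    exact (hT.edgeTube_lt hG hp h).le.trans ((hT.1.edgeTube_le_iff e' hτ).2 he')

/-- The rank is injective on a bundle and takes values in an interval with as many elements as the
bundle. So the edge of rank `j` can serve as `e(i,j)`. -/
lemma IsMaximalTubing.image_edgeRank (hG : IsConnected G ∨ G.Simple) (hT : IsMaximalTubing G T)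
    (e : E(G)) : (bundleOf e).image (edgeRank T) = Finset.Icc 1 (bundleOf e).card := by
  refine Finset.eq_of_subset_of_card_le ?_ ?_
  · intro q hq
    obtain ⟨y, hy, rfl⟩ := Finset.mem_image.1 hq
    rw [bundle_eq (mem_bundle.1 hy)]
    exact Finset.mem_Icc.2 ⟨one_le_edgeRank hT.1 y, edgeRank_le_card y⟩
  · rw [Finset.card_image_of_injOn, Nat.card_Icc, Nat.add_sub_cancel]
    intro y hy z hz h
    exact hT.edgeRank_injective hG ((mem_bundle.1 hy).symm.trans (mem_bundle.1 hz)) h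

lemma IsMaximalTubing.exists_edgeRank (hG : IsConnected G ∨ G.Simple) (hT : IsMaximalTubing G T)
    (e : E(G)) {q : ℕ} (h₁ : 1 ≤ q) (h₂ : q ≤ (bundleOf e).card) :
    ∃ y : E(G), Parallel G e.1 y.1 ∧ edgeRank T y = q := by
  have : q ∈ (bundleOf e).image (edgeRank T) := by
    rw [hT.image_edgeRank hG]
    exact Finset.mem_Icc.2 ⟨h₁, h₂⟩
  obtain ⟨y, hy, h⟩ := Finset.mem_image.1 this
  exact ⟨y, mem_bundle.1 hy, h⟩

/-- The edges of a bundle in a tube are its first ones. -/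
lemma IsMaximalTubing.mem_iff_edgeRank_le (hG : IsConnected G ∨ G.Simple)
    (hT : IsMaximalTubing G T) (hτ : τ ∈ insert G T) (e : E(G)) :
    e.1 ∈ E(τ) ↔ edgeRank T e ≤ (bundleOf e ∩ edges G τ).card := by
  constructor
  · intro h
    refine Finset.card_le_card (Finset.inter_subset_inter_left fun y hy => ?_)
    exact mem_edges.2 (((hT.1.edgeTube_le_iff e hτ).2 h).edgeSet_mono (mem_edges.1 hy))
  · intro h
    by_contra hcon
    have hinj : ((bundleOf e ∩ edges G τ).image (edgeRank T)).card =
        (bundleOf e ∩ edges G τ).card := by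
      refine Finset.card_image_of_injOn fun y hy z hz h => ?_
      have hy' := mem_bundle.1 (Finset.mem_inter.1 hy).1
      have hz' := mem_bundle.1 (Finset.mem_inter.1 hz).1
      exact hT.edgeRank_injective hG (hy'.symm.trans hz') h
    -- A tube contains an initial segment of each bundle. If it misses `e`, the edges of the bundle
    -- in it have distinct ranks below that of `e`, which are too few.
    have hsub : (bundleOf e ∩ edges G τ).image (edgeRank T) ⊆ Finset.Ico 1 (edgeRank T e) := by
      intro q hq
      obtain ⟨y, hy, rfl⟩ := Finset.mem_image.1 hq
      refine Finset.mem_Ico.2 ⟨one_le_edgeRank hT.1 y, ?_⟩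
      by_contra! hle
      exact hcon (hT.mem_of_edgeRank_le hG (mem_bundle.1 (Finset.mem_inter.1 hy).1) hle hτ
        (mem_edges.1 (Finset.mem_inter.1 hy).2))
    have := Finset.card_le_card hsub
    rw [hinj, Nat.card_Ico] at this
    have := one_le_edgeRank hT.1 e
    omega

/-- An edge is not the first one of its bundle exactly if its smallest tube contains a parallel
edge. -/
lemma two_le_edgeRank_iff (hT : IsTubing G T) (e : E(G)) : 2 ≤ edgeRank T e ↔
    ∃ e' ∈ E(edgeTube G T e.1), e' ≠ e.1 ∧ Parallel G e.1 e' := by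
  have hmem : e ∈ bundleOf e ∩ edges G (edgeTube G T e.1) :=
    Finset.mem_inter.2 ⟨self_mem_bundle e, mem_edges.2 (hT.edgeTube_spec e).2.mem⟩
  constructor
  · intro h
    obtain ⟨y, hy, hne⟩ := Finset.exists_mem_ne (show 1 < Finset.card _ from h) e
    obtain ⟨h₁, h₂⟩ := Finset.mem_inter.1 hy
    exact ⟨y.1, mem_edges.1 h₂, fun h => hne (Subtype.ext h), mem_bundle.1 h₁⟩
  · rintro ⟨e', he', hne, hp⟩
    refine Finset.one_lt_card.2 ⟨e, hmem, ⟨e', hp.mem_right⟩, ?_, fun h => hne (h ▸ rfl)⟩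
    exact Finset.mem_inter.2 ⟨mem_bundle.2 hp, mem_edges.2 he'⟩

lemma IsMaximalTubing.deleteEdges_edgeTube_mem (hG : IsConnected G ∨ G.Simple)
    (hT : IsMaximalTubing G T) {e : E(G)} (h : 2 ≤ edgeRank T e) :
    (edgeTube G T e.1).deleteEdges {e.1} ∈ T := by
  obtain ⟨e', he', hne, hp⟩ := (two_le_edgeRank_iff hT.1 e).1 h
  obtain ⟨h₁, h₂⟩ := hT.1.edgeTube_spec e
  exact hT.deleteEdges_mem hG h₁ h₂ hp hne he'

end Rank

/-! ### The function attached to a maximal tubing -/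

section Values

open Classical

variable {α β : Type*} {G s t τ : Graph α β} {T : Set (Graph α β)}

/-- The values on a bundle are determined by the tubing. -/
lemma IsBundleFunction.unique {f f' : V(G) ⊕ E(G) → ℤ} {B : Set β}
    (h : IsBundleFunction G T f B) (h' : IsBundleFunction G T f' B) (e : E(G)) (he : e.1 ∈ B) :
    f (.inr e) = f' (.inr e) := by
  obtain ⟨b, o, K, hr, hm, hK, h0, hs⟩ := h
  obtain ⟨b', o', K', hr', hm', hK', h0', hs'⟩ := h'
  have hcard : ∀ (b : ℕ) (o : Fin (b + 1) → E(G)), Set.range (fun j => (o j).1) = B →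
      StrictMono (fun j => missingTubes T (o j).1) → B.ncard = b + 1 := by
    intro b o hr hm
    rw [← hr, ← Set.image_univ, Set.ncard_image_of_injective, Set.ncard_univ, Nat.card_fin]
    intro i j hij
    exact hm.injective (congrArg (missingTubes T) hij)
  obtain rfl : b = b' := by
    have h₁ := hcard b o hr hm
    have h₂ := hcard b' o' hr' hm'
    omega
  -- Strictly increasing enumerations of the same finite set of integers agree, so the order of the
  -- bundle is forced, and with it the greatest tubes.
  have hfun : (fun j => missingTubes T (o j).1) = fun j => missingTubes T (o' j).1 := by
    refine (StrictMono.range_inj hm hm').1 ?_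
    have : ∀ o : Fin (b + 1) → E(G), Set.range (fun j => missingTubes T (o j).1) =
        missingTubes T '' Set.range (fun j => (o j).1) := fun o => by
      rw [← Set.range_comp]
      rfl
    rw [this, this, hr, hr']
  obtain rfl : o = o' := by
    funext j
    have hmem : (o j).1 ∈ Set.range (fun j => (o' j).1) := by
      rw [hr', ← hr]
      exact ⟨j, rfl⟩
    obtain ⟨i, hi⟩ := hmem
    have h₁ : missingTubes T (o' i).1 = missingTubes T (o' j).1 := by
      rw [show (o' i).1 = (o j).1 from hi]
      exact congrFun hfun j
    obtain rfl := hm'.injective h₁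
    exact Subtype.ext hi.symm
  obtain rfl : K = K' := by
    funext j
    exact (hK j).unique (hK' j)
  rw [← hr] at he
  obtain ⟨j, hj⟩ := he
  obtain rfl : o j = e := Subtype.ext hj
  refine Fin.cases ?_ (fun j => ?_) j
  · rw [h0, h0']
  · rw [hs, hs']

variable [Fintype V(G)] [Fintype E(G)]

/-- The correction of the value at an edge. -/
noncomputable def edgeGap (T : Set (Graph α β)) (e : E(G)) : ℤ :=
  2 * (cosize G (edgeTube G T e.1) : ℤ) + 1

/-- The value at an edge of the function attached to the maximal tubing `T`. -/
noncomputable def edgeValue (T : Set (Graph α β)) (e : E(G)) : ℤ :=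
  if edgeRank T e = 1 then base G + ∑ y ∈ bundleOf e with edgeRank T y ≠ 1, edgeGap T y
  else base G ^ (edgeRank T e - 1) * (base G - 1) - edgeGap T e

lemma edgeValue_of_eq_one {e : E(G)} (h : edgeRank T e = 1) :
    edgeValue T e = base G + ∑ y ∈ bundleOf e with edgeRank T y ≠ 1, edgeGap T y := if_pos h

lemma edgeValue_of_eq {e : E(G)} {q : ℕ} (hq : 1 ≤ q) (h : edgeRank T e = q + 1) :
    edgeValue T e = base G ^ q * (base G - 1) - edgeGap T e := by
  rw [edgeValue, if_neg (by omega), h, Nat.add_sub_cancel]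

/-- The number of missing tubes increases along a bundle. -/
lemma IsMaximalTubing.missingTubes_lt (hG : IsConnected G ∨ G.Simple)
    (hT : IsMaximalTubing G T) {e e' : E(G)} (hp : Parallel G e.1 e'.1)
    (h : edgeRank T e < edgeRank T e') : missingTubes T e.1 < missingTubes T e'.1 := by
  have hfin : T.Finite := hT.1.finite (Set.toFinite _) (Set.toFinite _)
  have hlt := hT.edgeTube_lt hG hp h
  have hmem := hT.deleteEdges_edgeTube_mem hG
    (show 2 ≤ edgeRank T e' by have := one_le_edgeRank hT.1 e; omega)
  refine Set.ncard_lt_ncard ?_ (hfin.subset (Set.sep_subset _ _))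
  rw [Set.ssubset_iff_of_subset]
  -- The smallest tube of `e'` with `e'` deleted is a member of `T` that misses `e'` but contains
  -- `e`.
  · refine ⟨_, ⟨hmem, by simp⟩, fun hcon => hcon.2 ?_⟩
    simp only [Graph.edgeSet_deleteEdges]
    refine ⟨hlt.le.edgeSet_mono (hT.1.edgeTube_spec e).2.mem, fun heq => ?_⟩
    obtain rfl : e = e' := Subtype.ext heq
    exact h.ne rfl
  · rintro t ⟨htT, ht⟩
    exact ⟨htT, fun h' => ht (hT.mem_of_edgeRank_le hG hp h.le (.inr htT) h')⟩

lemma IsMaximalTubing.isBundleFunction (hG : IsConnected G ∨ G.Simple)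
    (hT : IsMaximalTubing G T) {f : V(G) ⊕ E(G) → ℤ} (hf : ∀ y, f (.inr y) = edgeValue T y)
    (e : E(G)) : IsBundleFunction G T f (Subtype.val '' (bundleOf e : Set E(G))) := by
  obtain ⟨b, hb⟩ : ∃ b, (bundleOf e).card = b + 1 :=
    Nat.exists_eq_succ_of_ne_zero (Finset.card_pos.2 ⟨e, self_mem_bundle e⟩).ne'
  have hex : ∀ j : Fin (b + 1), ∃ y : E(G), Parallel G e.1 y.1 ∧ edgeRank T y = j.1 + 1 :=
    fun j => hT.exists_edgeRank hG e (by omega) (by omega)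
  choose o hop hor using hex
  have hpar : ∀ i j, Parallel G (o i).1 (o j).1 := fun i j => (hop i).symm.trans (hop j)
  have hsurj : ∀ y, Parallel G e.1 y.1 → ∃ j, o j = y := by
    intro y hy
    have h₁ := one_le_edgeRank hT.1 y
    have h₂ := edgeRank_le_card (T := T) y
    rw [← bundle_eq hy, hb] at h₂
    refine ⟨⟨edgeRank T y - 1, by omega⟩, hT.edgeRank_injective hG ((hop _).symm.trans hy) ?_⟩
    rw [hor]
    simp only
    omega
  -- The required greatest tube is the smallest tube of the next edge with that edge deleted. Its
  -- cosize is larger by one, which turns the `- 1` of the prescribed values into the `+ 1` of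
  -- `edgeGap`.
  have hgap : ∀ j : Fin b, 2 * (cosize G ((edgeTube G T (o j.succ).1).deleteEdges
      {(o j.succ).1}) : ℤ) - 1 = edgeGap T (o j.succ) := by
    intro j
    have h := hT.1.edgeTube_spec (o j.succ)
    rw [cosize_deleteEdges (hT.1.le h.1) h.2.mem, edgeGap]
    push_cast
    ring
  refine ⟨b, o, fun j => (edgeTube G T (o j.succ).1).deleteEdges {(o j.succ).1}, ?_, ?_, ?_, ?_, ?_⟩
  · ext y
    simp only [Set.mem_range, Set.mem_image, Finset.mem_coe, mem_bundle]
    constructor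
    · rintro ⟨j, rfl⟩
      exact ⟨o j, hop j, rfl⟩
    · rintro ⟨z, hz, rfl⟩
      obtain ⟨j, rfl⟩ := hsurj z hz
      exact ⟨j, rfl⟩
  · intro i j hij
    refine hT.missingTubes_lt hG (hpar i j) ?_
    rw [hor, hor]
    exact Nat.succ_lt_succ hij
  · intro j
    have hlt : edgeRank T (o j.castSucc) < edgeRank T (o j.succ) := by
      rw [hor, hor]
      simp
    have hspec := hT.1.edgeTube_spec (o j.succ)
    have hne : (o j.castSucc).1 ≠ (o j.succ).1 := fun h =>
      hlt.ne (congrArg _ (Subtype.ext h))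
    refine ⟨⟨hT.deleteEdges_edgeTube_mem hG (by rw [hor]; simp), ?_, by simp⟩, ?_⟩
    · simp only [Graph.edgeSet_deleteEdges]
      exact ⟨(hT.edgeTube_lt hG (hpar _ _) hlt).le.edgeSet_mono
        (hT.1.edgeTube_spec (o j.castSucc)).2.mem, hne⟩
    · rintro t ⟨htT, h₁, h₂⟩
      refine le_deleteEdges ?_ h₂
      obtain ⟨x, y, hx, hy⟩ := hpar j.castSucc j.succ
      rcases hT.1.nested (.inr htT) hspec.1
        (isLink_of_le (hT.1.le (.inr htT)) h₁ hx).left_mem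
        (isLink_of_le (hT.1.le hspec.1) hspec.2.mem hy).left_mem with h | h
      · exact h
      · exact (h₂ (h.edgeSet_mono hspec.2.mem)).elim
  · rw [hf, edgeValue_of_eq_one (by rw [hor]; rfl)]
    congr 1
    rw [bundle_eq (hop 0).symm]
    refine (Finset.sum_bij (fun (j : Fin b) _ => o j.succ) ?_ ?_ ?_ ?_).symm
    · intro j _
      simp [hop, hor]
    · intro i _ j _ hij
      have : edgeRank T (o i.succ) = edgeRank T (o j.succ) := congrArg _ hij
      rw [hor, hor] at this
      ext
      simpa using this
    · intro y hy
      obtain ⟨hy₁, hy₂⟩ := Finset.mem_filter.1 hy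
      obtain ⟨j, rfl⟩ := hsurj y (mem_bundle.1 hy₁)
      refine Fin.cases (fun h => ?_) (fun j _ => ⟨j, Finset.mem_univ _, rfl⟩) j hy₂
      exact (h (by rw [hor]; rfl)).elim
    · intro j _
      exact hgap j
  · intro j
    rw [hf, edgeValue_of_eq (q := j.1 + 1) (by omega) (by rw [hor]; simp), hgap]

/-- The sum of the values at the first edges of a bundle. -/
lemma IsMaximalTubing.sum_edgeValue (hG : IsConnected G ∨ G.Simple) (hT : IsMaximalTubing G T)
    (e : E(G)) {q : ℕ} (h₁ : 1 ≤ q) (h₂ : q ≤ (bundleOf e).card) :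
    ∑ y ∈ bundleOf e with edgeRank T y ≤ q, edgeValue T y =
      base G ^ q + ∑ y ∈ bundleOf e with q < edgeRank T y, edgeGap T y := by
  have hone : ∀ y : E(G), 1 ≤ edgeRank T y := one_le_edgeRank hT.1
  -- The powers telescope, since c^q + c^q (c - 1) = c^(q+1), and each later edge cancels one of the
  -- gaps carried by the first edge.
  induction q, h₁ using Nat.le_induction with
  | base =>
    obtain ⟨y, hy, hy1⟩ := hT.exists_edgeRank hG e le_rfl h₂
    have hsing : (bundleOf e).filter (fun z => edgeRank T z ≤ 1) = {y} := by
      ext z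
      simp only [Finset.mem_filter, mem_bundle, Finset.mem_singleton]
      refine ⟨fun ⟨hz, hz1⟩ => ?_, ?_⟩
      · exact hT.edgeRank_injective hG (hz.symm.trans hy) (by have := hone z; omega)
      · rintro rfl
        exact ⟨hy, hy1.le⟩
    rw [hsing, Finset.sum_singleton, edgeValue_of_eq_one hy1, pow_one, bundle_eq hy]
    congr 1
    refine Finset.sum_congr (Finset.filter_congr fun z _ => ?_) fun _ _ => rfl
    have := hone z
    omega
  | succ q hq ih =>
    obtain ⟨y, hy, hyq⟩ := hT.exists_edgeRank hG e (Nat.le_add_left 1 q) h₂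
    have hins : (bundleOf e).filter (fun z => edgeRank T z ≤ q + 1) =
        insert y ((bundleOf e).filter (fun z => edgeRank T z ≤ q)) := by
      ext z
      simp only [Finset.mem_filter, mem_bundle, Finset.mem_insert]
      constructor
      · rintro ⟨hz, hzq⟩
        by_cases h : edgeRank T z = q + 1
        · exact .inl (hT.edgeRank_injective hG (hz.symm.trans hy) (h.trans hyq.symm))
        · exact .inr ⟨hz, by omega⟩
      · rintro (rfl | ⟨hz, hzq⟩)
        · exact ⟨hy, hyq.le⟩
        · exact ⟨hz, by omega⟩
    have hins' : (bundleOf e).filter (fun z => q < edgeRank T z) =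
        insert y ((bundleOf e).filter (fun z => q + 1 < edgeRank T z)) := by
      ext z
      simp only [Finset.mem_filter, mem_bundle, Finset.mem_insert]
      constructor
      · rintro ⟨hz, hzq⟩
        by_cases h : edgeRank T z = q + 1
        · exact .inl (hT.edgeRank_injective hG (hz.symm.trans hy) (h.trans hyq.symm))
        · exact .inr ⟨hz, by omega⟩
      · rintro (rfl | ⟨hz, hzq⟩)
        · exact ⟨hy, by omega⟩
        · exact ⟨hz, by omega⟩
    have ih' := ih (by omega)
    rw [hins', Finset.sum_insert (by simp [hyq])] at ih'
    rw [hins, Finset.sum_insert (by simp [hyq]), ih', edgeValue_of_eq hq hyq]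
    ring

/-- The triangular structure of the equations for the nodes. -/
lemma IsMaximalTubing.card_nodes_nodeTube_lt (hT : IsMaximalTubing G T) (x y : V(G))
    (hτ : τ ∈ insert G T) (hx : NewNode T τ x.1) (hy : y.1 ∈ V(τ)) (hne : y ≠ x) :
    (nodes G (nodeTube G T y.1)).card < (nodes G τ).card := by
  have hle := (hT.1.nodeTube_le_iff y hτ).2 hy
  refine Finset.card_lt_card (Finset.ssubset_iff_of_subset ?_ |>.2 ⟨x, mem_nodes.2 hx.mem, ?_⟩)
  · exact fun z hz => mem_nodes.2 (hle.vertexSet_mono (mem_nodes.1 hz))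
  · intro hmem
    obtain ⟨h₁, h₂⟩ := hT.1.nodeTube_spec y
    have heq := le_antisymm hle (hx.le hT.1 hτ h₁ (mem_nodes.1 hmem))
    rw [heq] at h₂
    exact hne (Subtype.ext (h₂.eq hT hτ hx))

/-- In the smallest tube of `x`, every other node has a smallest tube with fewer nodes, so the
equations are triangular. They are solved over ℤ to define the function of a tubing, and over ℝ to
separate directions. -/
lemma IsMaximalTubing.existsUnique_nodes {M : Type*} [AddCommGroup M] (hT : IsMaximalTubing G T)
    (D : V(G) → M) : ∃! f : V(G) → M, ∀ x : V(G), ∑ y ∈ nodes G (nodeTube G T x.1), f y = D x :=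
  existsUnique_triangular (fun x => (nodes G (nodeTube G T x.1)).card) _
    (fun x => mem_nodes.2 (hT.1.nodeTube_spec x).2.mem)
    (fun x y hy hne => hT.card_nodes_nodeTube_lt x y (hT.1.nodeTube_spec x).1
      (hT.1.nodeTube_spec x).2 (mem_nodes.1 hy) hne) D

/-- If the values at the edges are the prescribed ones, it suffices to prescribe the sums over the
smallest tubes of the nodes. -/
lemma IsMaximalTubing.excess_eq_zero (hG : IsConnected G ∨ G.Simple) (hT : IsMaximalTubing G T)
    {f : V(G) ⊕ E(G) → ℤ} (hf : ∀ y, f (.inr y) = edgeValue T y)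
    (hn : ∀ x : V(G), excess f (nodeTube G T x.1) = 0) (hτ : τ ∈ insert G T) :
    excess f τ = 0 := by
  refine wellFounded_subgraph (Set.toFinite V(G)) (Set.toFinite E(G))
    (P := fun τ => τ ∈ insert G T → excess f τ = 0) ?_ τ (hT.1.le hτ) hτ
  intro τ hτG ih hτ
  rcases hT.1.exists_main (Set.toFinite _) (Set.toFinite _) hτ with ⟨w, hw⟩ | ⟨e, he, hpar⟩
  · have := hT.1.nodeTube_eq ⟨w, hτG.vertexSet_mono hw.mem⟩ hτ hw
    rw [← this]
    exact hn ⟨w, _⟩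
  -- The value at a later edge is chosen so that deleting it from its smallest tube leaves the
  -- excess unchanged. The remaining subgraph is a smaller tube of `T`.
  · obtain ⟨e, rfl⟩ : ∃ y : E(G), y.1 = e := ⟨⟨e, hτG.edgeSet_mono he.mem⟩, rfl⟩
    have heq := hT.1.edgeTube_eq e hτ he
    have h2 : 2 ≤ edgeRank T e := (two_le_edgeRank_iff hT.1 e).2 (heq ▸ hpar)
    obtain ⟨q, hq⟩ : ∃ q, edgeRank T e = q + 1 := ⟨edgeRank T e - 1, by omega⟩
    have hmem := hT.deleteEdges_edgeTube_mem hG h2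
    rw [heq] at hmem
    rw [excess_deleteEdges f hτG he.mem (q := q) (by rw [← hq, edgeRank, heq]),
      ih _ (deleteEdges_lt he.mem) (.inr hmem), hf, edgeValue_of_eq (by omega) hq, edgeGap, heq]
    ring

/-- Every maximal tubing has exactly one function with the prescribed properties. -/
theorem IsMaximalTubing.existsUnique_isVertexFunction (hG : IsConnected G ∨ G.Simple)
    (hT : IsMaximalTubing G T) : ∃! f : V(G) ⊕ E(G) → ℤ, IsVertexFunction G T f := by
  obtain ⟨g, hg, hguniq⟩ := hT.existsUnique_nodes fun x : V(G) =>
    tubeValue G (nodeTube G T x.1) - ∑ y ∈ edges G (nodeTube G T x.1), edgeValue T y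
  have hval : ∀ y : E(G), (Sum.elim g (edgeValue T) : V(G) ⊕ E(G) → ℤ) (.inr y) = edgeValue T y :=
    fun y => rfl
  have hzero : ∀ τ ∈ insert G T, excess (Sum.elim g (edgeValue T)) τ = 0 := by
    refine fun τ hτ => hT.excess_eq_zero hG hval (fun x => ?_) hτ
    rw [excess, sumOver_eq]
    simp only [Sum.elim_inl, Sum.elim_inr, hg]
    ring
  have hbun : ∀ B ∈ bundles G, IsBundleFunction G T (Sum.elim g (edgeValue T)) B := by
    intro B hB
    obtain ⟨e, rfl⟩ := mem_bundles_iff.1 hB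
    exact hT.isBundleFunction hG hval e
  refine ⟨_, ⟨hbun, fun t ht => excess_eq_zero_iff.1 (hzero t (.inr ht)),
    excess_eq_zero_iff.1 (hzero G (Set.mem_insert _ _))⟩, fun f hf => ?_⟩
  have hedge : ∀ y, f (.inr y) = edgeValue T y := by
    intro y
    have hB := mem_bundles_iff.2 ⟨y, rfl⟩
    exact (hf.bundle _ hB).unique (hbun _ hB) y ⟨y, self_mem_bundle y, rfl⟩
  have hnode : (fun x => f (.inl x)) = g := by
    refine hguniq _ fun x => ?_
    have hsum : sumOver f (nodeTube G T x.1) = tubeValue G (nodeTube G T x.1) := by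
      rcases (hT.1.nodeTube_spec x).1 with h | h
      · rw [h]
        exact hf.whole
      · exact hf.tube _ h
    rw [sumOver_eq] at hsum
    simp only [hedge] at hsum
    linarith
  funext z
  rcases z with x | y
  · exact congrFun hnode x
  · exact hedge y

lemma IsVertexFunction.edge_eq (hG : IsConnected G ∨ G.Simple) (hT : IsMaximalTubing G T)
    {f : V(G) ⊕ E(G) → ℤ} (hf : IsVertexFunction G T f) (y : E(G)) :
    f (.inr y) = edgeValue T y :=
  (hf.bundle _ (mem_bundles_iff.2 ⟨y, rfl⟩)).unique
    (hT.isBundleFunction hG (f := Sum.elim 0 (edgeValue T)) (fun _ => rfl) y) y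
    ⟨y, self_mem_bundle y, rfl⟩

lemma IsVertexFunction.excess_eq_zero {f : V(G) ⊕ E(G) → ℤ} (hf : IsVertexFunction G T f)
    (hτ : τ ∈ insert G T) : excess f τ = 0 := by
  rw [excess_eq_zero_iff]
  rcases hτ with rfl | hτ
  · exact hf.whole
  · exact hf.tube τ hτ

/-- The sum of the values over a bundle does not depend on the tubing. -/
lemma sum_bundle_of_isVertexFunction (hG : IsConnected G ∨ G.Simple) (hT : IsMaximalTubing G T)
    {f : V(G) ⊕ E(G) → ℤ} (hf : IsVertexFunction G T f) (e : E(G)) :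
    ∑ y ∈ bundleOf e, f (.inr y) = base G ^ (bundleOf e).card := by
  have h := hT.sum_edgeValue hG e (Finset.card_pos.2 ⟨e, self_mem_bundle e⟩) le_rfl
  have hle : ∀ y ∈ bundleOf e, edgeRank T y ≤ (bundleOf e).card := fun y hy => by
    rw [bundle_eq (mem_bundle.1 hy)]
    exact edgeRank_le_card y
  rw [Finset.filter_true_of_mem hle,
    Finset.filter_false_of_mem fun y hy => (hle y hy).not_gt, Finset.sum_empty, add_zero] at h
  rw [← h]
  exact Finset.sum_congr rfl fun y _ => hf.edge_eq hG hT y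

/-- A real vector whose sums over the bundles, over `G` and over the tubes of a maximal tubing
vanish is zero. -/
lemma IsMaximalTubing.eq_zero_of_sums (hG : IsConnected G ∨ G.Simple) (hT : IsMaximalTubing G T)
    {g : V(G) → ℝ} {h : E(G) → ℝ} (hB : ∀ e : E(G), ∑ y ∈ bundleOf e, h y = 0)
    (hs : ∀ τ ∈ insert G T, ∑ x ∈ nodes G τ, g x + ∑ y ∈ edges G τ, h y = 0) :
    g = 0 ∧ h = 0 := by
  -- The equations of the smallest tube of `e` and of the same tube without `e` differ by `h e`.
  -- Only the first edges remain, and the bundle sums take care of them.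
  have h₂ : ∀ e : E(G), edgeRank T e ≠ 1 → h e = 0 := by
    intro e he
    have h2 : 2 ≤ edgeRank T e := by
      have := one_le_edgeRank hT.1 e
      omega
    obtain ⟨hm, hnew⟩ := hT.1.edgeTube_spec e
    have e₁ := hs _ hm
    have e₂ := hs _ (.inr (hT.deleteEdges_edgeTube_mem hG h2))
    rw [nodes_deleteEdges, edges_deleteEdges] at e₂
    rw [← Finset.add_sum_erase _ _ (mem_edges.2 hnew.mem)] at e₁
    linarith
  have hh : h = 0 := by
    funext e
    by_cases he : edgeRank T e = 1
    · have := hB e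
      rw [← Finset.add_sum_erase _ _ (self_mem_bundle e), Finset.sum_eq_zero] at this
      · simpa using this
      · intro y hy
        obtain ⟨hne, hy⟩ := Finset.mem_erase.1 hy
        refine h₂ y fun h1 => hne ?_
        exact (hT.edgeRank_injective hG (mem_bundle.1 hy) (he.trans h1.symm)).symm
    · exact h₂ e he
  refine ⟨?_, hh⟩
  refine (hT.existsUnique_nodes (fun _ => (0 : ℝ))).unique (fun x => ?_) (fun x => by simp)
  have := hs _ (hT.1.nodeTube_spec x).1
  rw [hh] at this
  simpa using this

end Values

/-! ### The inequalities -/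

section Inequalities

open Classical

variable {α β : Type*} {G s t τ : Graph α β} {T : Set (Graph α β)}

variable [Fintype V(G)] [Fintype E(G)]

lemma size_eq_card : size G = Fintype.card V(G) + Fintype.card E(G) := by
  rw [size, ← Nat.card_coe_set_eq, ← Nat.card_coe_set_eq, Nat.card_eq_fintype_card,
    Nat.card_eq_fintype_card]

lemma base_eq : base G = (size G : ℤ) ^ 2 := rfl

lemma one_le_base (hV : V(G).Nonempty) : 1 ≤ base G := by
  have : 1 ≤ size G := by
    rw [size_eq_card]
    have : 0 < Fintype.card V(G) := Fintype.card_pos_iff.2 hV.to_subtype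
    omega
  rw [base_eq]
  exact one_le_pow₀ (by exact_mod_cast this)

lemma cosize_lt_size (ht : t ≤ G) (hne : V(t).Nonempty) : cosize G t < size G := by
  have h := cosize_add ht
  obtain ⟨x, hx⟩ := hne
  have : 0 < (nodes G t).card := Finset.card_pos.2 ⟨⟨x, ht.vertexSet_mono hx⟩, mem_nodes.2 hx⟩
  omega

lemma four_le_size (hl : G.Loopless) {e e' : E(G)} (hp : Parallel G e.1 e'.1) (hne : e' ≠ e) :
    4 ≤ size G := by
  obtain ⟨x, y, h, -⟩ := hp
  have hxy : x ≠ y := h.ne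
  have h₁ : 1 < Fintype.card V(G) := Fintype.one_lt_card_iff.2
    ⟨⟨x, h.left_mem⟩, ⟨y, h.right_mem⟩, fun h => hxy (congrArg Subtype.val h)⟩
  have h₂ : 1 < Fintype.card E(G) := Fintype.one_lt_card_iff.2 ⟨e', e, hne⟩
  rw [size_eq_card]
  omega

/-! ### Estimates for the values at the edges -/

lemma edgeGap_pos (e : E(G)) : 0 < edgeGap T e := by
  unfold edgeGap
  positivity

lemma edgeGap_lt (hT : IsTubing G T) (e : E(G)) : edgeGap T e < 2 * size G := by
  obtain ⟨h, hn⟩ := hT.edgeTube_spec e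
  obtain ⟨x, y, hxy⟩ := Graph.exists_isLink_of_mem_edgeSet hn.mem
  have := cosize_lt_size (hT.le h) ⟨x, hxy.left_mem⟩
  unfold edgeGap
  omega

lemma sum_edgeGap_le (hT : IsTubing G T) (S : Finset E(G)) :
    ∑ y ∈ S, edgeGap T y ≤ S.card * (2 * size G) := by
  have := Finset.sum_le_card_nsmul S (edgeGap T) (2 * (size G : ℤ))
    fun y _ => (edgeGap_lt hT y).le
  simpa using this

/-- The value at the first edge of a bundle with several edges is small. -/
lemma edgeValue_first_lt (hl : G.Loopless) (hT : IsTubing G T) {e e' : E(G)}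
    (hp : Parallel G e.1 e'.1) (hne : e' ≠ e) (he : edgeRank T e = 1) :
    edgeValue T e + 2 * size G + 1 < base G * (base G - 1) := by
  have h4 := four_le_size hl hp hne
  rw [edgeValue_of_eq_one he, base_eq]
  have h₁ := sum_edgeGap_le hT ((bundleOf e).filter fun y => edgeRank T y ≠ 1)
  have h₂ : (((bundleOf e).filter fun y => edgeRank T y ≠ 1).card : ℤ) ≤ size G := by
    have := Finset.card_le_univ ((bundleOf e).filter fun y => edgeRank T y ≠ 1)
    have := size_eq_card (G := G)
    omega
  have h4' : (4 : ℤ) ≤ size G := by exact_mod_cast h4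
  have h₃ : (((bundleOf e).filter fun y => edgeRank T y ≠ 1).card : ℤ) * (2 * size G) ≤
      size G * (2 * size G) := mul_le_mul_of_nonneg_right h₂ (by positivity)
  -- The value is at most N² + 2N², and 3N² + 2N + 1 < N²(N² - 1) for N ≥ 4.
  generalize (size G : ℤ) = N at *
  nlinarith [mul_nonneg (sub_nonneg.2 h4') (sub_nonneg.2 h4'), pow_pos (by linarith : 0 < N) 2,
    mul_le_mul h4' h4' (by norm_num) (by linarith)]

/-- The values at the later edges of a bundle are large. -/
lemma edgeValue_later_ge (hl : G.Loopless) (hT : IsTubing G T) {e : E(G)} {q : ℕ} (hq : 1 ≤ q)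
    (he : edgeRank T e = q + 1) : base G ^ q ≤ edgeValue T e ∧
      base G * (base G - 1) ≤ edgeValue T e + 2 * size G := by
  obtain ⟨e', he', hne, hp⟩ := (two_le_edgeRank_iff hT e).1 (by omega)
  have h4 := four_le_size hl (e' := ⟨e', hp.mem_right⟩) hp
    (fun h => hne (congrArg Subtype.val h))
  have h4' : (4 : ℤ) ≤ size G := by exact_mod_cast h4
  have hc : (16 : ℤ) ≤ base G := by rw [base_eq]; nlinarith
  have hcN : 2 * (size G : ℤ) ≤ base G := by rw [base_eq]; nlinarith
  have hgap := edgeGap_lt hT e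
  have hpow : base G ≤ base G ^ q := le_self_pow₀ (by linarith) (by omega)
  rw [edgeValue_of_eq hq he]
  constructor <;> nlinarith

lemma edgeValue_nonneg (hl : G.Loopless) (hT : IsTubing G T) (e : E(G)) : 0 ≤ edgeValue T e := by
  have h1 := one_le_edgeRank hT e
  by_cases h : edgeRank T e = 1
  · rw [edgeValue_of_eq_one h]
    have : 0 ≤ ∑ y ∈ bundleOf e with edgeRank T y ≠ 1, edgeGap T y :=
      Finset.sum_nonneg fun y _ => (edgeGap_pos y).le
    have : 0 ≤ base G := by rw [base_eq]; positivity
    linarith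
  · obtain ⟨q, hq⟩ : ∃ q, edgeRank T e = q + 1 := ⟨edgeRank T e - 1, by omega⟩
    refine le_trans ?_ (edgeValue_later_ge hl hT (by omega) hq).1
    have : 0 ≤ base G := by rw [base_eq]; positivity
    positivity

/-- The values at `q` edges of a bundle add up to at least `c ^ q`. -/
lemma IsMaximalTubing.pow_card_le_sum (hG : IsConnected G ∨ G.Simple) (hl : G.Loopless)
    (hT : IsMaximalTubing G T) (e : E(G)) {S : Finset E(G)} (hS : S ⊆ bundleOf e)
    (hne : S.Nonempty) : base G ^ S.card ≤ ∑ y ∈ S, edgeValue T y := by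
  have h1 : 1 ≤ S.card := Finset.card_pos.2 hne
  -- An edge of rank above |S| outweighs c^|S| on its own. If there is none, `S` consists of the
  -- first |S| edges of the bundle, and their sum is known.
  by_cases h : ∃ y ∈ S, S.card < edgeRank T y
  · obtain ⟨y, hy, hlt⟩ := h
    obtain ⟨q, hq⟩ : ∃ q, edgeRank T y = q + 1 := ⟨edgeRank T y - 1, by omega⟩
    have hbase := one_le_base (Set.nonempty_of_mem
      (Graph.exists_isLink_of_mem_edgeSet e.2).choose_spec.choose_spec.left_mem)
    calc base G ^ S.card ≤ base G ^ q := pow_le_pow_right₀ hbase (by omega)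
      _ ≤ edgeValue T y := (edgeValue_later_ge hl hT.1 (by omega) hq).1
      _ ≤ ∑ y ∈ S, edgeValue T y :=
        Finset.single_le_sum (f := edgeValue T) (fun z _ => edgeValue_nonneg hl hT.1 z) hy
  · push Not at h
    have hcard : S.card ≤ (bundleOf e).card := Finset.card_le_card hS
    have hsub : S ⊆ (bundleOf e).filter fun y => edgeRank T y ≤ S.card :=
      fun y hy => Finset.mem_filter.2 ⟨hS hy, h y hy⟩
    have heq : S = (bundleOf e).filter fun y => edgeRank T y ≤ S.card := by
      refine Finset.eq_of_subset_of_card_le hsub ?_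
      have hinj : (((bundleOf e).filter fun y => edgeRank T y ≤ S.card).image (edgeRank T)).card =
          ((bundleOf e).filter fun y => edgeRank T y ≤ S.card).card := by
        refine Finset.card_image_of_injOn fun y hy z hz hyz => ?_
        exact hT.edgeRank_injective hG ((mem_bundle.1 (Finset.mem_filter.1 hy).1).symm.trans
          (mem_bundle.1 (Finset.mem_filter.1 hz).1)) hyz
      rw [← hinj]
      refine (Finset.card_le_card (t := Finset.Icc 1 S.card) fun q hq => ?_).trans (by simp)
      obtain ⟨y, hy, rfl⟩ := Finset.mem_image.1 hq
      exact Finset.mem_Icc.2 ⟨one_le_edgeRank hT.1 y, (Finset.mem_filter.1 hy).2⟩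
    have hsum := hT.sum_edgeValue hG e h1 hcard
    rw [← heq] at hsum
    rw [hsum]
    have : 0 ≤ ∑ y ∈ bundleOf e with S.card < edgeRank T y, edgeGap T y :=
      Finset.sum_nonneg fun y _ => (edgeGap_pos y).le
    linarith

lemma sum_eq_sum_bundles {M : Type*} [AddCommMonoid M] (g : E(G) → M) (S : Finset E(G)) :
    ∑ y ∈ S, g y = ∑ B ∈ bundleFinset G, ∑ y ∈ B ∩ S, g y := by
  rw [← Finset.sum_fiberwise_of_maps_to (t := bundleFinset G) (g := bundleOf)
    (fun y _ => bundle_mem y)]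
  refine Finset.sum_congr rfl fun B hB => Finset.sum_congr ?_ fun _ _ => rfl
  obtain ⟨e, -, rfl⟩ := Finset.mem_image.1 hB
  ext y
  simp only [Finset.mem_filter, Finset.mem_inter]
  rw [← mem_bundle_iff_eq, and_comm]

/-- A lower bound for the sum of the values at the edges of a subgraph. -/
lemma IsMaximalTubing.sum_edges_ge (hG : IsConnected G ∨ G.Simple) (hl : G.Loopless)
    (hT : IsMaximalTubing G T) (t : Graph α β) :
    ∑ B ∈ bundleFinset G, base G ^ (B ∩ edges G t).card - (bundleFinset G).card ≤
      ∑ y ∈ edges G t, edgeValue T y := by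
  have hcard : ((bundleFinset G).card : ℤ) = ∑ B ∈ bundleFinset G, (1 : ℤ) := by simp
  rw [sum_eq_sum_bundles, hcard, ← Finset.sum_sub_distrib]
  refine Finset.sum_le_sum fun B hB => ?_
  obtain ⟨e, -, rfl⟩ := Finset.mem_image.1 hB
  -- A bundle without edges in `t` has empty sum but contributes c^0 = 1 to Λ(t); hence the
  -- subtracted number of bundles.
  rcases (bundleOf e ∩ edges G t).eq_empty_or_nonempty with h | h
  · simp [h]
  · have := hT.pow_card_le_sum hG hl e Finset.inter_subset_left h
    linarith

/-- An upper bound for the sum of the values at the edges of a tube. -/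
lemma IsMaximalTubing.sum_edges_le (hG : IsConnected G ∨ G.Simple)
    (hT : IsMaximalTubing G T) (hτ : τ ∈ insert G T) :
    ∑ y ∈ edges G τ, edgeValue T y ≤ ∑ B ∈ bundleFinset G, base G ^ (B ∩ edges G τ).card +
      Fintype.card E(G) * (2 * size G) := by
  have h₁ : ∑ y ∈ edges G τ, edgeValue T y ≤
      ∑ B ∈ bundleFinset G, (base G ^ (B ∩ edges G τ).card + ∑ y ∈ B, edgeGap T y) := by
    rw [sum_eq_sum_bundles]
    refine Finset.sum_le_sum fun B hB => ?_
    obtain ⟨e, -, rfl⟩ := Finset.mem_image.1 hB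
    have hnonneg : ∀ S : Finset E(G), 0 ≤ ∑ y ∈ S, edgeGap T y :=
      fun S => Finset.sum_nonneg fun y _ => (edgeGap_pos y).le
    rcases (bundleOf e ∩ edges G τ).eq_empty_or_nonempty with h | h
    · rw [h]
      have := hnonneg (bundleOf e)
      simp
      linarith
    · have heq : bundleOf e ∩ edges G τ =
          (bundleOf e).filter fun y => edgeRank T y ≤ (bundleOf e ∩ edges G τ).card := by
        ext y
        simp only [Finset.mem_inter, Finset.mem_filter, mem_edges]
        refine and_congr_right fun hy => ?_
        rw [hT.mem_iff_edgeRank_le hG hτ, bundle_eq (mem_bundle.1 hy)]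
      have hsum := hT.sum_edgeValue hG e (Finset.card_pos.2 h)
        (Finset.card_le_card Finset.inter_subset_left)
      rw [← heq] at hsum
      rw [hsum]
      have hle := Finset.sum_le_sum_of_subset_of_nonneg
        (Finset.filter_subset (fun y => (bundleOf e ∩ edges G τ).card < edgeRank T y) (bundleOf e))
        (f := edgeGap T) fun y _ _ => (edgeGap_pos y).le
      linarith
  refine h₁.trans ?_
  rw [Finset.sum_add_distrib]
  have h₂ : ∑ B ∈ bundleFinset G, ∑ y ∈ B, edgeGap T y = ∑ y : E(G), edgeGap T y := by
    rw [sum_eq_sum_bundles]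
    simp
  have h₃ := sum_edgeGap_le hT.1 (Finset.univ : Finset E(G))
  rw [h₂]
  simpa using h₃

lemma card_bundleFinset_le : (bundleFinset G).card ≤ Fintype.card E(G) :=
  (Finset.card_image_le (s := (Finset.univ : Finset E(G))) (f := bundleOf)).trans_eq
    Finset.card_univ

/-! ### Estimates for the values at the nodes -/

/-- Bounds for the sum of the values at the nodes of a tube. -/
lemma IsVertexFunction.sum_nodes_bounds (hG : IsConnected G ∨ G.Simple) (hl : G.Loopless)
    (hT : IsMaximalTubing G T) {f : V(G) ⊕ E(G) → ℤ} (hf : IsVertexFunction G T f)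
    (hτ : τ ∈ insert G T) :
    base G ^ (nodes G τ).card - Fintype.card E(G) * (2 * size G) ≤
        ∑ x ∈ nodes G τ, f (.inl x) ∧
      ∑ x ∈ nodes G τ, f (.inl x) ≤
        base G ^ (nodes G τ).card + Fintype.card E(G) + (cosize G τ : ℤ) ^ 2 := by
  have h₀ := hf.excess_eq_zero hτ
  rw [excess, sumOver_eq, tubeValue_eq (hT.1.le hτ)] at h₀
  simp only [hf.edge_eq hG hT] at h₀
  have h₁ := hT.sum_edges_ge hG hl τ
  have h₂ := hT.sum_edges_le hG hτ
  have h₃ : ((bundleFinset G).card : ℤ) ≤ Fintype.card E(G) := by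
    exact_mod_cast card_bundleFinset_le
  have h₄ : (0 : ℤ) ≤ (cosize G τ : ℤ) ^ 2 := by positivity
  constructor <;> linarith

/-- For a tube with `ν` nodes and p = c^(ν-1), the main term of the node sum is p N². Each of the `ν
- 1` nodes other than the new one takes at most p + k + (N-1)², the edges distort the sum by at most
2kN, and the new node must still exceed p + k + N². -/
lemma node_estimate {N n k p ν : ℤ} (hN : N = n + k) (hk : 0 ≤ k) (hν : 2 ≤ ν) (hνn : ν ≤ n)
    (hp : N ^ 2 ≤ p) :
    p + k + N ^ 2 + (ν - 1) * (p + k + (N - 1) ^ 2) + k * (2 * N) < p * N ^ 2 := by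
  have h₁ : ν * p + ν * k + (ν - 1) * (N - 1) ^ 2 + N ^ 2 + k * (2 * N) < p * N ^ 2 := by
    have hN2 : 2 ≤ N := by linarith
    have e₁ : ν * k ≤ N * k := mul_le_mul_of_nonneg_right (by linarith) hk
    have e₂ : (ν - 1) * (N - 1) ^ 2 ≤ (N - k - 1) * (N - 1) ^ 2 :=
      mul_le_mul_of_nonneg_right (by linarith) (sq_nonneg _)
    have e₃ : N ^ 2 * (N ^ 2 - (N - k)) ≤ p * (N ^ 2 - ν) := by
      refine mul_le_mul hp (by linarith) (by nlinarith) (by nlinarith)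
    rcases hN2.eq_or_lt with h | h
    · obtain rfl : k = 0 := by linarith
      subst h
      nlinarith
    · have e₄ : 0 ≤ k * N * (N - 3) := mul_nonneg (mul_nonneg hk (by linarith)) (by linarith)
      have e₅ : 0 ≤ k * (N - 1) ^ 2 := mul_nonneg hk (sq_nonneg _)
      have e₆ : 0 < N ^ 3 * (N - 2) := mul_pos (by positivity) (by linarith)
      nlinarith
  linarith

/-- The value at a node dominates everything that depends on smaller tubes. -/
lemma IsVertexFunction.node_bounds (hG : IsConnected G ∨ G.Simple) (hl : G.Loopless)
    (hT : IsMaximalTubing G T) {f : V(G) ⊕ E(G) → ℤ} (hf : IsVertexFunction G T f) (x : V(G)) :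
    0 ≤ f (.inl x) ∧ ∀ ν, (nodes G (nodeTube G T x.1)).card = ν + 1 → 1 ≤ ν →
      base G ^ ν + Fintype.card E(G) + (size G : ℤ) ^ 2 < f (.inl x) := by
  have hc : 1 ≤ base G := one_le_base ⟨x.1, x.2⟩
  induction hn : (nodes G (nodeTube G T x.1)).card using Nat.strong_induction_on
    generalizing x with
  | _ m ih =>
    subst hn
    obtain ⟨hτ, hnew⟩ := hT.1.nodeTube_spec x
    set τ := nodeTube G T x.1 with hτdef
    have hxmem : x ∈ nodes G τ := mem_nodes.2 hnew.mem
    have hpos : 1 ≤ (nodes G τ).card := Finset.card_pos.2 ⟨x, hxmem⟩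
    have hlow := (hf.sum_nodes_bounds hG hl hT hτ).1
    rw [← Finset.add_sum_erase _ _ hxmem] at hlow
    have hsmall : ∀ y ∈ nodes G τ, y ≠ x → (nodes G (nodeTube G T y.1)).card < (nodes G τ).card :=
      fun y hy hne => hT.card_nodes_nodeTube_lt x y hτ hnew (mem_nodes.1 hy) hne
    have key : ∀ ν, (nodes G τ).card = ν + 1 → 1 ≤ ν →
        base G ^ ν + Fintype.card E(G) + (size G : ℤ) ^ 2 < f (.inl x) := by
      intro ν hν hν1
      -- The value at `y` is at most the node sum over the smallest tube of `y`, because all terms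
      -- of that sum are nonnegative by induction.
      have hup : ∀ y ∈ (nodes G τ).erase x, f (.inl y) ≤
          base G ^ ν + Fintype.card E(G) + ((size G : ℤ) - 1) ^ 2 := by
        intro y hy
        obtain ⟨hne, hy⟩ := Finset.mem_erase.1 hy
        obtain ⟨hσ, hynew⟩ := hT.1.nodeTube_spec y
        have hle := hsmall y hy hne
        have hz : ∀ z ∈ nodes G (nodeTube G T y.1), 0 ≤ f (.inl z) := by
          intro z hz
          refine (ih _ ?_ z rfl).1
          by_cases hzy : z = y
          · rw [hzy]
            exact hle
          · exact (hT.card_nodes_nodeTube_lt y z hσ hynew (mem_nodes.1 hz) hzy).trans hle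
        have h₁ := Finset.single_le_sum (f := fun z => f (.inl z)) hz (mem_nodes.2 hynew.mem)
        have h₂ := (hf.sum_nodes_bounds hG hl hT hσ).2
        have h₃ : base G ^ (nodes G (nodeTube G T y.1)).card ≤ base G ^ ν :=
          pow_le_pow_right₀ hc (by omega)
        have h₄ := cosize_lt_size (hT.1.le hσ) ⟨_, hynew.mem⟩
        have h₅ : (cosize G (nodeTube G T y.1) : ℤ) ^ 2 ≤ ((size G : ℤ) - 1) ^ 2 :=
          pow_le_pow_left₀ (by positivity) (by omega) 2
        linarith
      have hsum := Finset.sum_le_card_nsmul _ _ _ hup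
      rw [Finset.card_erase_of_mem hxmem, hν, Nat.add_sub_cancel, nsmul_eq_mul] at hsum
      have hνn : ν + 1 ≤ Fintype.card V(G) := hν ▸ Finset.card_le_univ _
      have hest := node_estimate (N := size G) (n := Fintype.card V(G)) (k := Fintype.card E(G))
        (p := base G ^ ν) (ν := ν + 1) (by exact_mod_cast size_eq_card (G := G)) (by positivity)
        (by omega) (by exact_mod_cast hνn)
        (by rw [← base_eq]; exact le_self_pow₀ hc (by omega))
      rw [hν, pow_succ, base_eq (G := G)] at hlow
      rw [base_eq] at hsum hest ⊢
      simp only [add_sub_cancel_right] at hest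
      linarith
    refine ⟨?_, key⟩
    -- In the absence of loops, a tube with a single node has no edges, so its equation gives the
    -- value at the node outright, as a sum of nonnegative terms.
    rcases hpos.eq_or_lt with h1 | h1
    · have h₀ := hf.excess_eq_zero hτ
      rw [excess, sumOver_eq, tubeValue_eq (hT.1.le hτ)] at h₀
      have hedges : edges G τ = ∅ := by
        refine Finset.eq_empty_of_forall_notMem fun y hy => ?_
        obtain ⟨a, b, hab⟩ := Graph.exists_isLink_of_mem_edgeSet (mem_edges.1 hy)
        have hle := hT.1.le hτ
        have := Finset.card_le_one.1 h1.ge ⟨a, hle.vertexSet_mono hab.left_mem⟩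
          (mem_nodes.2 hab.left_mem) ⟨b, hle.vertexSet_mono hab.right_mem⟩
          (mem_nodes.2 hab.right_mem)
        exact (hab.mono hle).ne (congrArg Subtype.val this)
      have herase : (nodes G τ).erase x = ∅ := by
        rw [← Finset.card_eq_zero, Finset.card_erase_of_mem hxmem, ← h1]
      rw [← Finset.add_sum_erase _ _ hxmem, herase, hedges] at h₀
      simp only [Finset.sum_empty, Finset.inter_empty, Finset.card_empty, pow_zero,
        Finset.sum_const, nsmul_eq_mul, mul_one, add_zero] at h₀
      have e₁ : 0 ≤ base G ^ (nodes G τ).card := pow_nonneg (by linarith) _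
      have e₂ : (0 : ℤ) ≤ (cosize G τ : ℤ) ^ 2 := by positivity
      have e₃ : (0 : ℤ) ≤ (bundleFinset G).card := by positivity
      linarith
    · have := key ((nodes G τ).card - 1) (by omega) (by omega)
      have e₁ : 0 ≤ base G ^ ((nodes G τ).card - 1) := pow_nonneg (by linarith) _
      have e₂ : (0 : ℤ) ≤ (size G : ℤ) ^ 2 := by positivity
      have e₃ : (0 : ℤ) ≤ Fintype.card E(G) := by positivity
      linarith

/-! ### Positivity of the excess -/

/-- The inequality for a subgraph that contains the new node of `τ` but not all its nodes. -/
lemma IsVertexFunction.excess_pos_of_newNode (hG : IsConnected G ∨ G.Simple) (hl : G.Loopless)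
    (hT : IsMaximalTubing G T) {f : V(G) ⊕ E(G) → ℤ} (hf : IsVertexFunction G T f)
    (hτ : τ ∈ insert G T) (ht : t ≤ τ) {w : α} (hw : NewNode T τ w) (hwt : w ∈ V(t))
    (hV : V(t) ≠ V(τ)) : 0 < excess f t := by
  have hτG := hT.1.le hτ
  have htG := ht.trans hτG
  obtain ⟨x, rfl⟩ : ∃ x : V(G), x.1 = w := ⟨⟨w, hτG.vertexSet_mono hw.mem⟩, rfl⟩
  have hc : 1 ≤ base G := one_le_base ⟨x.1, x.2⟩
  have heq := hT.1.nodeTube_eq x hτ hw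
  have hss : nodes G t ⊂ nodes G τ := by
    obtain ⟨y, hy, hyt⟩ := Set.not_subset.1 fun h => hV (ht.vertexSet_mono.antisymm h)
    refine Finset.ssubset_iff_of_subset ?_ |>.2 ⟨⟨y, hτG.vertexSet_mono hy⟩, by simpa, by simpa⟩
    exact fun z hz => mem_nodes.2 (ht.vertexSet_mono (mem_nodes.1 hz))
  have hlt := Finset.card_lt_card hss
  have hpos : 1 ≤ (nodes G t).card := Finset.card_pos.2 ⟨x, mem_nodes.2 hwt⟩
  -- As `t` misses a node of τ, the value at the new node exceeds c^|V(t)| + |G - t|² by more than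
  -- the number of edges, which covers the deficit of the edge sum.
  have hfx := (hf.node_bounds hG hl hT x).2 ((nodes G τ).card - 1) (by rw [heq]; omega) (by omega)
  have hsum := Finset.single_le_sum (f := fun z => f (.inl z)) (s := nodes G t)
    (fun z _ => (hf.node_bounds hG hl hT z).1) (mem_nodes.2 hwt)
  have hedges := hT.sum_edges_ge hG hl t
  have hbun : ((bundleFinset G).card : ℤ) ≤ Fintype.card E(G) := by
    exact_mod_cast card_bundleFinset_le
  have hpow : base G ^ (nodes G t).card ≤ base G ^ ((nodes G τ).card - 1) :=
    pow_le_pow_right₀ hc (by omega)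
  have hcos : (cosize G t : ℤ) ^ 2 ≤ (size G : ℤ) ^ 2 := by
    have := cosize_lt_size htG ⟨_, hwt⟩
    exact pow_le_pow_left₀ (by positivity) (by omega) 2
  rw [excess, sumOver_eq, tubeValue_eq htG]
  simp only [hf.edge_eq hG hT] at hsum ⊢
  linarith

lemma restrict_le_of_le {F : Set β} (h : t ≤ τ) (hF : E(t) ⊆ F) : t ≤ τ.restrict F := by
  refine le_of_subset h Graph.restrict_le h.vertexSet_mono fun e he => ?_
  exact ⟨h.edgeSet_mono he, hF he⟩

/-- The inequality for a proper subgraph that contains all the nodes of a tube with a new node. -/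
lemma IsVertexFunction.excess_pos_of_spanning (hG : IsConnected G ∨ G.Simple) (hl : G.Loopless)
    (hT : IsMaximalTubing G T) {f : V(G) ⊕ E(G) → ℤ} (hf : IsVertexFunction G T f)
    (hτ : τ ∈ insert G T) {w : α} (hw : NewNode T τ w) (ht : t ≤ τ) (hfull : IsFull G t)
    (hV : V(t) = V(τ)) (hne : t ≠ τ) : 0 < excess f t := by
  have hτG := hT.1.le hτ
  -- The missing edges of τ are added one at a time. Each addition strictly lowers the excess, which
  -- ends at 0.
  induction hn : (edges G τ \ edges G t).card using Nat.strong_induction_on generalizing t with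
  | _ m ih =>
    subst hn
    have htG := hfull.le
    have hnonempty : (edges G τ \ edges G t).Nonempty := by
      by_contra hcon
      rw [Finset.not_nonempty_iff_eq_empty, Finset.sdiff_eq_empty_iff_subset] at hcon
      refine hne (eq_of_sets_eq ht le_rfl hV (ht.edgeSet_mono.antisymm fun y hy => ?_))
      exact mem_edges.1 (hcon (mem_edges.2 hy : (⟨y, hτG.edgeSet_mono hy⟩ : E(G)) ∈ edges G τ))
    -- A missing edge with smallest tube as small as possible is added first, so that all edges of
    -- still smaller tubes are already in `t`.
    obtain ⟨e, he, hmin⟩ := Finset.exists_min_image _ (fun y => size (edgeTube G T y.1)) hnonempty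
    obtain ⟨heτ, het⟩ := Finset.mem_sdiff.1 he
    rw [mem_edges] at heτ het
    obtain ⟨hμ, hnew⟩ := hT.1.edgeTube_spec e
    set μ := edgeTube G T e.1 with hμdef
    have hμτ : μ ≤ τ := (hT.1.edgeTube_le_iff e hτ).2 heτ
    have hμG := hT.1.le hμ
    -- the edges that belong to smaller tubes than `e` lie in `t`
    have hsmall : ∀ y : E(G), edgeTube G T y.1 < μ → y.1 ∈ E(t) := by
      intro y hy
      by_contra hyt
      have hyτ := (hT.1.edgeTube_le_iff y hτ).1 (hy.le.trans hμτ)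
      exact (size_lt_size (Set.toFinite _) (Set.toFinite _) hμG hy).not_ge
        (hmin y (Finset.mem_sdiff.2 ⟨mem_edges.2 hyτ, fun h => hyt (mem_edges.1 h)⟩))
    set t' := τ.restrict (insert e.1 E(t)) with ht'
    have hle : t ≤ t' := restrict_le_of_le ht (Set.subset_insert _ _)
    have hV' : V(t') = V(τ) := rfl
    have ht'τ : t' ≤ τ := Graph.restrict_le
    have ht'G := ht'τ.trans hτG
    have het' : e.1 ∈ E(t') := ⟨heτ, Set.mem_insert _ _⟩
    have hE' : edges G t' = insert e (edges G t) := by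
      ext y
      simp only [mem_edges, Finset.mem_insert, ht', Graph.edgeSet_restrict, Set.mem_inter_iff,
        Set.mem_insert_iff, Subtype.ext_iff]
      constructor
      · exact fun h => h.2
      · rintro (h | h)
        · exact ⟨h ▸ heτ, .inl h⟩
        · exact ⟨ht.edgeSet_mono h, .inr h⟩
    have hdel : t'.deleteEdges {e.1} = t := by
      refine eq_of_sets_eq (Graph.deleteEdges_le.trans ht'G) htG (by simp [hV', hV]) ?_
      ext y
      simp only [Graph.edgeSet_deleteEdges, ht', Graph.edgeSet_restrict]
      constructor
      · rintro ⟨⟨-, h | h⟩, h'⟩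
        · exact (h' h).elim
        · exact h
      · exact fun h => ⟨⟨ht.edgeSet_mono h, .inr h⟩, fun h' => het (h' ▸ h)⟩
    have hfull' : IsFull G t' := by
      refine ⟨ht'G, fun x hx y hy hxy => (hfull.adj x ?_ y ?_ hxy).mono hle⟩
      · rw [hV]; exact hx
      · rw [hV]; exact hy
    have hnonneg : 0 ≤ excess f t' := by
      by_cases heq : t' = τ
      · rw [heq, hf.excess_eq_zero hτ]
      · refine (ih _ ?_ ht'τ hfull' hV' heq rfl).le
        refine Finset.card_lt_card (Finset.ssubset_iff_of_subset ?_ |>.2 ⟨e, he, ?_⟩)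
        · rw [hE']
          exact Finset.sdiff_subset_sdiff le_rfl (Finset.subset_insert _ _)
        · simp [het']
    obtain ⟨x, y, hxy⟩ := Graph.exists_isLink_of_mem_edgeSet e.2
    have hxyτ := isLink_of_le hτG heτ hxy
    obtain ⟨e₁, he₁, hp₁, -⟩ := hfull.exists_parallel hxy (hV ▸ hxyτ.left_mem)
      (hV ▸ hxyτ.right_mem)
    have hne₁ : (⟨e₁, hp₁.mem_right⟩ : E(G)) ≠ e := fun h => het (h ▸ he₁)
    have hq₁ : 1 ≤ (bundleOf e ∩ edges G t).card := Finset.card_pos.2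
      ⟨⟨e₁, hp₁.mem_right⟩, Finset.mem_inter.2 ⟨mem_bundle.2 hp₁, mem_edges.2 he₁⟩⟩
    have hcard : (bundleOf e ∩ edges G t').card = (bundleOf e ∩ edges G t).card + 1 := by
      rw [hE', Finset.inter_insert_of_mem (self_mem_bundle e), Finset.card_insert_of_notMem]
      exact fun h => het (mem_edges.1 (Finset.mem_inter.1 h).2)
    have hstep := excess_deleteEdges f ht'G het' hcard
    rw [hdel, hf.edge_eq hG hT] at hstep
    have hc : 1 ≤ base G := one_le_base ⟨x, hxy.left_mem⟩
    suffices h : edgeValue T e + 2 * cosize G t' + 1 <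
        base G ^ (bundleOf e ∩ edges G t).card * (base G - 1) by linarith
    -- The full subgraph `t` contains another edge of the bundle, so the exponent is at least 1, and
    -- the value at a first edge is well below c(c - 1).
    by_cases hrank : edgeRank T e = 1
    · have hfirst := edgeValue_first_lt hl hT.1 (e' := ⟨e₁, hp₁.mem_right⟩) hp₁ hne₁ hrank
      have hcos := cosize_lt_size ht'G ⟨x, (isLink_of_le ht'G het' hxy).left_mem⟩
      have hpow : base G * (base G - 1) ≤
          base G ^ (bundleOf e ∩ edges G t).card * (base G - 1) :=
        mul_le_mul_of_nonneg_right (le_self_pow₀ hc (by omega)) (by linarith)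
      have : (cosize G t' : ℤ) ≤ size G := by exact_mod_cast hcos.le
      linarith
    · have hr1 := one_le_edgeRank hT.1 e
      obtain ⟨j, hj⟩ : ∃ j, edgeRank T e = j + 1 := ⟨edgeRank T e - 1, by omega⟩
      obtain ⟨e₂, he₂, hne₂, hp₂⟩ := (two_le_edgeRank_iff hT.1 e).1 (by omega)
      have hjq : j ≤ (bundleOf e ∩ edges G t).card := by
        have : ((bundleOf e ∩ edges G μ).erase e).card = j := by
          rw [Finset.card_erase_of_mem, ← edgeRank, hj, Nat.add_sub_cancel]
          exact Finset.mem_inter.2 ⟨self_mem_bundle e, mem_edges.2 hnew.mem⟩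
        rw [← this]
        refine Finset.card_le_card fun y hy => ?_
        obtain ⟨hye, hy⟩ := Finset.mem_erase.1 hy
        obtain ⟨hyB, hyμ⟩ := Finset.mem_inter.1 hy
        refine Finset.mem_inter.2 ⟨hyB, mem_edges.2 (hsmall y (lt_of_le_of_ne
          ((hT.1.edgeTube_le_iff y hμ).2 (mem_edges.1 hyμ)) fun h => hye ?_))⟩
        exact (hT.edgeTube_injective hG (mem_bundle.1 hyB) h.symm).symm
      have hμt' : μ ≤ t' := by
        refine le_of_subset hμτ ht'τ hμτ.vertexSet_mono fun y hy => ?_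
        obtain ⟨y, rfl⟩ : ∃ z : E(G), z.1 = y := ⟨⟨y, hμG.edgeSet_mono hy⟩, rfl⟩
        have hyle := (hT.1.edgeTube_le_iff y hμ).2 hy
        rcases hyle.eq_or_lt with h | h
        · have hynew := (hT.1.edgeTube_spec y).2
          rw [h] at hynew
          rw [hnew.eq hG hT hμ hp₂ hne₂ he₂ hynew]
          exact het'
        · exact hle.edgeSet_mono (hsmall y h)
      -- Equality would give `μ = τ`, with both a new node and a new edge that has a parallel one.
      -- Strictness is what decides when the powers of `c` tie: the gap of `e` is measured at `μ`,
      -- the increment of the square at the larger `t'`.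
      have hlt : μ < t' := by
        refine lt_of_le_of_ne hμt' fun heq => ?_
        have hwμ : w ∈ V(μ) := by
          rw [heq]
          exact hw.mem
        have hμeq : μ = τ := le_antisymm hμτ (hw.le hT.1 hτ hμ hwμ)
        exact hnew.not_newNode hG hT hμ hp₂ hne₂ he₂ (hμeq ▸ hw)
      have hcos := cosize_lt_cosize ht'G hlt
      rw [edgeValue_of_eq (by omega) hj, edgeGap, ← hμdef]
      have hpow : base G ^ j * (base G - 1) ≤
          base G ^ (bundleOf e ∩ edges G t).card * (base G - 1) :=
        mul_le_mul_of_nonneg_right (pow_le_pow_right₀ hc hjq) (by linarith)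
      have : (cosize G t' : ℤ) < cosize G μ := by exact_mod_cast hcos
      linarith

/-- Replace the edge `e` of `t` by the parallel edge `e₁`. -/
lemma exists_swap (hfull : IsFull G t) (hc : IsConnected t) (hτG : τ ≤ G) (ht : t ≤ τ)
    {e e₁ : E(G)} (hp : Parallel G e.1 e₁.1) (he : e.1 ∈ E(t)) (he₁ : e₁.1 ∉ E(t))
    (he₁τ : e₁.1 ∈ E(τ)) : ∃ t', t' ≤ τ.deleteEdges {e.1} ∧ IsFull G t' ∧ IsConnected t' ∧
      e₁.1 ∈ E(t') ∧ t'.deleteEdges {e₁.1} = t.deleteEdges {e.1} := by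
  have htG := hfull.le
  have hne : e₁.1 ≠ e.1 := fun h => he₁ (h ▸ he)
  obtain ⟨x, y, hxy⟩ := Graph.exists_isLink_of_mem_edgeSet he
  have hxy₁ : τ.IsLink e₁.1 x y := isLink_of_le hτG he₁τ (hp.isLink (hxy.mono htG))
  set t' := (τ.induce V(t)).restrict (insert e₁.1 (E(t) \ {e.1})) with ht'
  have hVle : V(t) ⊆ V(τ) := ht.vertexSet_mono
  have ht'τ : t' ≤ τ := Graph.restrict_le.trans (Graph.induce_le hVle)
  have hlink : ∀ f a b, t.IsLink f a b → f ≠ e.1 → t'.IsLink f a b := fun f a b h hf =>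
    ⟨.inr ⟨h.edge_mem, hf⟩, h.mono ht, h.left_mem, h.right_mem⟩
  have hlink₁ : t'.IsLink e₁.1 x y := ⟨.inl rfl, hxy₁, hxy.left_mem, hxy.right_mem⟩
  have hadj : ∀ a b, t.Adj a b → t'.Adj a b := by
    rintro a b ⟨f, hf⟩
    by_cases hfe : f = e.1
    · subst hfe
      refine ⟨e₁.1, ?_⟩
      exact isLink_of_le (ht'τ.trans hτG) hlink₁.edge_mem (hp.isLink (hf.mono htG))
    · exact ⟨f, hlink f a b hf hfe⟩
  have hV' : V(t') = V(t) := rfl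
  have he' : e.1 ∉ E(t') := by
    rintro ⟨-, h | h⟩
    · exact hne h.symm
    · exact h.2 rfl
  refine ⟨t', le_deleteEdges ht'τ he', ⟨ht'τ.trans hτG, fun a ha b hb h =>
    hadj a b (hfull.adj a ha b hb h)⟩, ⟨hc.1, fun a ha b hb =>
    ReflTransGen.mono hadj _ _ (hc.2 a ha b hb)⟩, hlink₁.edge_mem, ?_⟩
  refine eq_of_sets_eq (Graph.deleteEdges_le.trans (ht'τ.trans hτG))
    (Graph.deleteEdges_le.trans htG) (by simp [hV']) ?_
  ext f
  simp only [Graph.edgeSet_deleteEdges]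
  constructor
  · rintro ⟨⟨-, h | h⟩, h'⟩
    · exact (h' h).elim
    · exact h
  · rintro ⟨h, h'⟩
    obtain ⟨a, b, hab⟩ := Graph.exists_isLink_of_mem_edgeSet h
    exact ⟨(hlink f a b hab h').edge_mem, fun h₁ => he₁ (h₁ ▸ h)⟩

/-- The sum over a tube that does not belong to the tubing exceeds the prescribed value. -/
theorem IsVertexFunction.excess_pos (hG : IsConnected G ∨ G.Simple) (hl : G.Loopless)
    (hT : IsMaximalTubing G T) {f : V(G) ⊕ E(G) → ℤ} (hf : IsVertexFunction G T f)
    (hfull : IsFull G t) (hc : IsConnected t) (htT : t ∉ insert G T) : 0 < excess f t := by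
  -- Induction over the members τ of `T ∪ {G}` that contain `t`. If no smaller one contains it, `t`
  -- contains an essential new element of τ.
  have main : ∀ τ ≤ G, τ ∈ insert G T → ∀ t ≤ τ, IsFull G t → IsConnected t → t ∉ insert G T →
      0 < excess f t := by
    refine wellFounded_subgraph (Set.toFinite V(G)) (Set.toFinite E(G)) ?_
    intro τ hτG ih hτ t ht hfull hc htT
    by_cases hmin : ∃ u ∈ T, u < τ ∧ t ≤ u
    · obtain ⟨u, hu, huτ, htu⟩ := hmin
      exact ih u huτ (.inr hu) t htu hfull hc htT
    push Not at hmin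
    have htne : t ≠ τ := fun h => htT (h ▸ hτ)
    rcases hT.1.exists_new (Set.toFinite _) (Set.toFinite _) hτ ht hc hmin with
      ⟨w, hwt, hw⟩ | ⟨e, het, he, hpar⟩
    · by_cases hV : V(t) = V(τ)
      · exact hf.excess_pos_of_spanning hG hl hT hτ hw ht hfull hV htne
      · exact hf.excess_pos_of_newNode hG hl hT hτ ht hw hwt hV
    obtain ⟨e, rfl⟩ : ∃ y : E(G), y.1 = e := ⟨⟨e, hτG.edgeSet_mono he.mem⟩, rfl⟩
    have hμ := hT.1.edgeTube_eq e hτ he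
    have h2 : 2 ≤ edgeRank T e := (two_le_edgeRank_iff hT.1 e).2 (hμ ▸ hpar)
    obtain ⟨j, hj⟩ : ∃ j, edgeRank T e = j + 1 := ⟨edgeRank T e - 1, by omega⟩
    have hdelT := hT.deleteEdges_edgeTube_mem hG h2
    rw [hμ] at hdelT
    have hnonneg : ∀ t' ≤ τ.deleteEdges {e.1}, IsFull G t' → IsConnected t' →
        0 ≤ excess f t' := by
      intro t' ht' hfull' hc'
      by_cases hmem : t' ∈ insert G T
      · exact (hf.excess_eq_zero hmem).ge
      · exact (ih _ (deleteEdges_lt he.mem) (.inr hdelT) t' ht' hfull' hc' hmem).le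
    have htG := hfull.le
    obtain ⟨x, y, hxy⟩ := Graph.exists_isLink_of_mem_edgeSet e.2
    have hc1 : 1 ≤ base G := one_le_base ⟨x, hxy.left_mem⟩
    have hcosτ : (cosize G τ : ℤ) < cosize G t := by
      exact_mod_cast cosize_lt_cosize hτG (lt_of_le_of_ne ht htne)
    -- If a parallel edge remains, `t` minus `e` has nonnegative excess, and restoring `e` adds at
    -- least 2|G - t| - 2|G - τ| > 0.
    by_cases hother : ∃ e' ∈ E(t), e' ≠ e.1 ∧ Parallel G e.1 e'
    · obtain ⟨e', he', hne', hp'⟩ := hother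
      obtain ⟨q, hq⟩ : ∃ q, (bundleOf e ∩ edges G t).card = q + 1 :=
        Nat.exists_eq_succ_of_ne_zero (Finset.card_pos.2 ⟨e, Finset.mem_inter.2
          ⟨self_mem_bundle e, mem_edges.2 het⟩⟩).ne'
      have hqj : q ≤ j := by
        have : (bundleOf e ∩ edges G t).card ≤ edgeRank T e := by
          rw [edgeRank, hμ]
          refine Finset.card_le_card (Finset.inter_subset_inter_left fun y hy => ?_)
          exact mem_edges.2 (ht.edgeSet_mono (mem_edges.1 hy))
        omega
      have h0 := hnonneg (t.deleteEdges {e.1}) (Graph.deleteEdges_mono_left ht _)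
        (hfull.deleteEdges hp' hne' he') (hc.deleteEdges htG hp' hne' he')
      rw [excess_deleteEdges f htG het hq, hf.edge_eq hG hT, edgeValue_of_eq (by omega) hj,
        edgeGap, hμ]
      have hpow : base G ^ q * (base G - 1) ≤ base G ^ j * (base G - 1) :=
        mul_le_mul_of_nonneg_right (pow_le_pow_right₀ hc1 hqj) (by linarith)
      linarith
    · push Not at hother
      -- If `e` is alone in its bundle within `t`, deleting it would destroy fullness. It is
      -- replaced by the first edge of the bundle: this keeps the prescribed sum, leaves the excess
      -- nonnegative by induction, and strictly lowers the actual sum.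
      obtain ⟨e₁, hp₁, hr₁⟩ := hT.exists_edgeRank hG e le_rfl
        (Finset.card_pos.2 ⟨e, self_mem_bundle e⟩)
      have hne₁ : e₁ ≠ e := by
        rintro rfl
        omega
      have he₁t : e₁.1 ∉ E(t) := fun h => hother _ h (fun h => hne₁ (Subtype.ext h)) hp₁
      have he₁τ := hT.mem_of_edgeRank_le hG hp₁.symm (by omega) hτ he.mem
      obtain ⟨t', ht', hfull', hc', he₁', hdel⟩ :=
        exists_swap hfull hc hτG ht hp₁ het he₁t he₁τ
      have h0 := hnonneg t' ht' hfull' hc'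
      have hcard : (bundleOf e ∩ edges G t).card = 0 + 1 := by
        rw [Finset.card_eq_one]
        refine ⟨e, Finset.eq_singleton_iff_unique_mem.2 ⟨Finset.mem_inter.2
          ⟨self_mem_bundle e, mem_edges.2 het⟩, fun y hy => ?_⟩⟩
        obtain ⟨hy₁, hy₂⟩ := Finset.mem_inter.1 hy
        by_contra hye
        exact hother y.1 (mem_edges.1 hy₂) (fun h => hye (Subtype.ext h)) (mem_bundle.1 hy₁)
      have hEdel : (edges G t').erase e₁ = (edges G t).erase e := by
        rw [← edges_deleteEdges, ← edges_deleteEdges, hdel]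
      have hcard' : (bundleOf e₁ ∩ edges G t').card = 0 + 1 := by
        have hmem : e₁ ∈ bundleOf e₁ ∩ edges G t' :=
          Finset.mem_inter.2 ⟨self_mem_bundle e₁, mem_edges.2 he₁'⟩
        rw [← Finset.card_erase_add_one hmem, ← Finset.inter_erase, hEdel, ← bundle_eq hp₁,
          Finset.inter_erase, Finset.card_erase_of_mem, hcard]
        exact Finset.mem_inter.2 ⟨self_mem_bundle e, mem_edges.2 het⟩
      have hcos : cosize G t' = cosize G t := by
        have h₁ := cosize_deleteEdges hfull'.le he₁'
        have h₂ := cosize_deleteEdges htG het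
        rw [hdel] at h₁
        omega
      have s₁ := excess_deleteEdges f hfull'.le he₁' hcard'
      have s₂ := excess_deleteEdges f htG het hcard
      rw [hdel, hcos, hf.edge_eq hG hT] at s₁
      rw [hf.edge_eq hG hT] at s₂
      have b₁ := edgeValue_first_lt hl hT.1 hp₁.symm hne₁.symm hr₁
      have b₂ := (edgeValue_later_ge hl hT.1 (by omega) hj).2
      linarith
  exact main G le_rfl (Set.mem_insert _ _) t hfull.le hfull hc htT

end Inequalities

/-! ### Simple polytopes from exchange systems -/

section Polytopes

variable {ι W : Type*} [AddCommGroup W] [Module ℝ W]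

variable {Q : Set ι → Prop} {p : Set ι → W}

/-- The convex hull of the points attached to the facets that contain `S`. -/
def faceHull (Q : Set ι → Prop) (p : Set ι → W) (S : Set ι) : Set W :=
  convexHull ℝ (p '' {T | Maximal Q T ∧ S ⊆ T})

lemma faceHull_anti {S S' : Set ι} (h : S ⊆ S') : faceHull Q p S' ⊆ faceHull Q p S :=
  convexHull_mono (Set.image_mono fun _ hT => ⟨hT.1, h.trans hT.2⟩)

lemma mem_faceHull {S T : Set ι} (hT : Maximal Q T) (h : S ⊆ T) : p T ∈ faceHull Q p S :=
  subset_convexHull ℝ _ ⟨T, ⟨hT, h⟩, rfl⟩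

lemma vectorSpan_faceHull_le (S : Set ι) :
    vectorSpan ℝ (faceHull Q p S) ≤ vectorSpan ℝ (p '' {T | Maximal Q T}) := by
  rw [← direction_affineSpan, faceHull, affineSpan_convexHull, direction_affineSpan]
  exact vectorSpan_mono ℝ (Set.image_mono fun _ hT => hT.1)

lemma sub_mem_vectorSpan {x y : W} (hx : x ∈ faceHull Q p ∅) (hy : y ∈ faceHull Q p ∅) :
    x - y ∈ vectorSpan ℝ (p '' {T | Maximal Q T}) :=
  vectorSpan_faceHull_le ∅ (vsub_mem_vectorSpan ℝ hx hy)

variable [TopologicalSpace W] {l : ι → W →L[ℝ] ℝ} {c : ι → ℝ}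

/-- Points attached to the facets of a simplicial complex `Q`, and linear inequalities attached to
its vertices, that describe a simple polytope: a point satisfies with equality exactly the
inequalities of its facet, every element of a facet can be exchanged, and the
functionals of a facet separate the directions of the polytope. -/
structure ExchangeSystem (Q : Set ι → Prop) (p : Set ι → W) (l : ι → W →L[ℝ] ℝ) (c : ι → ℝ) :
    Prop where
  finite : {T | Maximal Q T}.Finite
  finite_of : ∀ S, Q S → S.Finite
  subset : ∀ T S, Q T → S ⊆ T → Q S
  exists_maximal : ∀ S, Q S → ∃ T, Maximal Q T ∧ S ⊆ T
  eq : ∀ T, Maximal Q T → ∀ t ∈ T, l t (p T) = c t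
  lt : ∀ T T', Maximal Q T → Maximal Q T' → ∀ t ∈ T', t ∉ T → c t < l t (p T)
  flip : ∀ T, Maximal Q T → ∀ t ∈ T, ∃ T', Maximal Q T' ∧ T \ {t} ⊆ T' ∧ t ∉ T'
  separate : ∀ T, Maximal Q T → ∀ y ∈ vectorSpan ℝ (p '' {T | Maximal Q T}),
    (∀ t ∈ T, l t y = 0) → y = 0

namespace ExchangeSystem

lemma le_of_mem (h : ExchangeSystem Q p l c) {S : Set ι} (hS : Q S) {t : ι} (ht : t ∈ S) {x : W}
    (hx : x ∈ faceHull Q p ∅) : c t ≤ l t x := by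
  obtain ⟨T', hT', hST'⟩ := h.exists_maximal S hS
  refine convexHull_min (t := {x | c t ≤ l t x}) ?_
    (convex_halfSpace_ge (l t).toLinearMap.isLinear _) hx
  rintro _ ⟨T, ⟨hT, -⟩, rfl⟩
  by_cases htT : t ∈ T
  · exact (h.eq T hT t htT).ge
  · exact (h.lt T T' hT hT' t (hST' ht) htT).le

lemma eq_of_mem (h : ExchangeSystem Q p l c) {S : Set ι} {t : ι} (ht : t ∈ S) {x : W}
    (hx : x ∈ faceHull Q p S) : l t x = c t := by
  refine convexHull_min (t := {x | l t x = c t}) ?_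
    (convex_hyperplane (l t).toLinearMap.isLinear _) hx
  rintro _ ⟨T, ⟨hT, hST⟩, rfl⟩
  exact h.eq T hT t (hST ht)

/-- In a convex combination on which the inequality of `t` is tight, every point with nonzero weight
is tight for `t`, and by strictness such a point belongs to a facet containing `t`. -/
lemma mem_faceHull_iff (h : ExchangeSystem Q p l c) {S : Set ι} (hS : Q S) {x : W} :
    x ∈ faceHull Q p S ↔ x ∈ faceHull Q p ∅ ∧ ∀ t ∈ S, l t x = c t := by
  refine ⟨fun hx => ⟨faceHull_anti (Set.empty_subset S) hx, fun t ht => h.eq_of_mem ht hx⟩, ?_⟩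
  rintro ⟨hx, heq⟩
  obtain ⟨κ, _, w, z, hw, hw1, hz, rfl⟩ := mem_convexHull_iff_exists_fintype.1 hx
  choose T hT hTz using hz
  have key : ∀ i, w i ≠ 0 → S ⊆ T i := by
    intro i hi t ht
    by_contra htT
    obtain ⟨T', hT', hST'⟩ := h.exists_maximal S hS
    have hnonneg : ∀ j ∈ Finset.univ, 0 ≤ w j * (l t (z j) - c t) := fun j _ =>
      mul_nonneg (hw j) (sub_nonneg.2 (h.le_of_mem hS ht (subset_convexHull ℝ _
        ⟨T j, hT j, hTz j⟩)))
    have hsum : ∑ j, w j * (l t (z j) - c t) = 0 := by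
      have := heq t ht
      simp only [map_sum, map_smul, smul_eq_mul] at this
      simp only [mul_sub, Finset.sum_sub_distrib, ← Finset.sum_mul, hw1, this, one_mul, sub_self]
    have hi0 := (Finset.sum_eq_zero_iff_of_nonneg hnonneg).1 hsum i (Finset.mem_univ i)
    rcases mul_eq_zero.1 hi0 with h0 | h0
    · exact hi h0
    · have := h.lt (T i) T' (hT i).1 hT' t (hST' ht) htT
      rw [hTz i] at this
      linarith
  classical
  have hfilter : ∑ i, w i • z i = ∑ i with w i ≠ 0, w i • z i := by
    refine (Finset.sum_filter_of_ne (p := fun i => w i ≠ 0) fun i _ hi hwi => hi ?_).symm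
    rw [hwi, zero_smul]
  rw [hfilter]
  refine (convex_convexHull ℝ _).sum_mem (fun i _ => hw i) ?_ fun i hi => ?_
  · rw [Finset.sum_filter_ne_zero, hw1]
  · exact subset_convexHull ℝ _ ⟨T i, ⟨(hT i).1, key i (Finset.mem_filter.1 hi).2⟩, hTz i⟩

/-- The exposing functional is minus the sum of the `l t` over `S`: the sum is minimal exactly where
all its inequalities are tight. -/
lemma isExposed_faceHull (h : ExchangeSystem Q p l c) {S : Set ι} (hS : Q S) :
    IsExposed ℝ (faceHull Q p ∅) (faceHull Q p S) := by
  rintro -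
  obtain ⟨T, hT, hST⟩ := h.exists_maximal S hS
  have hfin := h.finite_of S hS
  have hle : ∀ x ∈ faceHull Q p ∅, ∀ t ∈ hfin.toFinset, c t ≤ l t x := fun x hx t ht =>
    h.le_of_mem hS (hfin.mem_toFinset.1 ht) hx
  refine ⟨-∑ t ∈ hfin.toFinset, l t, ?_⟩
  ext x
  rw [h.mem_faceHull_iff hS]
  refine and_congr_right fun hx => ?_
  simp only [neg_apply, sum_apply, neg_le_neg_iff]
  constructor
  · intro heq y hy
    refine Finset.sum_le_sum fun t ht => ?_
    rw [heq t (hfin.mem_toFinset.1 ht)]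
    exact hle y hy t ht
  · intro hmin t ht
    have h₁ := hmin (p T) (mem_faceHull hT (Set.empty_subset T))
    rw [Finset.sum_congr rfl fun t ht => h.eq T hT t (hST (hfin.mem_toFinset.1 ht))] at h₁
    have h₂ := Finset.sum_le_sum (hle x hx)
    exact ((Finset.sum_eq_sum_iff_of_le (hle x hx)).1 (le_antisymm h₂ h₁) t
      (hfin.mem_toFinset.2 ht)).symm

lemma nonempty_faceHull (h : ExchangeSystem Q p l c) {S : Set ι} (hS : Q S) :
    (faceHull Q p S).Nonempty := by
  obtain ⟨T, hT, hST⟩ := h.exists_maximal S hS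
  exact ⟨p T, mem_faceHull hT hST⟩

/-- If some `t` of `S'` is not in `S`, an exchange yields a facet containing `S` but not `t`, whose
point leaves the hyperplane of `t`. -/
lemma faceHull_subset_iff (h : ExchangeSystem Q p l c) {S S' : Set ι} (hS : Q S) (hS' : Q S') :
    faceHull Q p S ⊆ faceHull Q p S' ↔ S' ⊆ S := by
  refine ⟨fun hsub t ht => ?_, faceHull_anti⟩
  by_contra htS
  obtain ⟨T', hT', hST'⟩ := h.exists_maximal S' hS'
  obtain ⟨T, hT, hST, htT⟩ : ∃ T, Maximal Q T ∧ S ⊆ T ∧ t ∉ T := by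
    obtain ⟨T, hT, hST⟩ := h.exists_maximal S hS
    by_cases htT : t ∈ T
    · obtain ⟨T₁, hT₁, hsub, htT₁⟩ := h.flip T hT t htT
      exact ⟨T₁, hT₁, fun u hu => hsub ⟨hST hu, fun hut => htS (hut ▸ hu)⟩, htT₁⟩
    · exact ⟨T, hT, hST, htT⟩
  exact (h.lt T T' hT hT' t (hST' ht) htT).ne' (h.eq_of_mem ht (hsub (mem_faceHull hT hST)))

/-- The edge directions at a vertex. -/
lemma exists_directions (h : ExchangeSystem Q p l c) {T : Set ι} (hT : Maximal Q T) : ∃ d : ι → W,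
    (∀ t ∈ T, ∃ T', Maximal Q T' ∧ T \ {t} ⊆ T' ∧ d t = p T' - p T) ∧
    (∀ t ∈ T, 0 < l t (d t)) ∧ ∀ t ∈ T, ∀ s ∈ T, s ≠ t → l s (d t) = 0 := by
  choose! T' hT' hsub hnot using h.flip T hT
  refine ⟨fun t => p (T' t) - p T, fun t ht => ⟨T' t, hT' t ht, hsub t ht, rfl⟩, ?_, ?_⟩
  · intro t ht
    rw [map_sub, h.eq T hT t ht]
    linarith [h.lt (T' t) T (hT' t ht) hT t ht (hnot t ht)]
  · intro t ht s hs hst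
    rw [map_sub, h.eq T hT s hs, h.eq (T' t) (hT' t ht) s (hsub t ht ⟨hs, hst⟩), sub_self]

/-- The directions are dual to the functionals of `T` up to positive factors, and these functionals
separate vectors of the span. -/
lemma eq_sum_directions (h : ExchangeSystem Q p l c) {T : Set ι} (hT : Maximal Q T) {d : ι → W}
    (hd : ∀ t ∈ T, ∃ T', Maximal Q T' ∧ T \ {t} ⊆ T' ∧ d t = p T' - p T)
    (hpos : ∀ t ∈ T, 0 < l t (d t)) (hzero : ∀ t ∈ T, ∀ s ∈ T, s ≠ t → l s (d t) = 0)
    {y : W} (hy : y ∈ vectorSpan ℝ (p '' {T | Maximal Q T})) :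
    y = ∑ t ∈ (h.finite_of T hT.1).toFinset, (l t y / l t (d t)) • d t := by
  rw [← sub_eq_zero]
  refine h.separate T hT _ ?_ fun s hs => ?_
  · refine Submodule.sub_mem _ hy (Submodule.sum_mem _ fun t ht => Submodule.smul_mem _ _ ?_)
    obtain ⟨T', hT', -, heq⟩ := hd t ((h.finite_of T hT.1).mem_toFinset.1 ht)
    rw [heq]
    exact vsub_mem_vectorSpan ℝ ⟨T', hT', rfl⟩ ⟨T, hT, rfl⟩
  · rw [map_sub, map_sum, Finset.sum_eq_single_of_mem s ((h.finite_of T hT.1).mem_toFinset.2 hs)]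
    · rw [map_smul, smul_eq_mul, div_mul_cancel₀ _ (hpos s hs).ne', sub_self]
    · intro t ht hts
      rw [map_smul, hzero t ((h.finite_of T hT.1).mem_toFinset.1 ht) s hs hts.symm, smul_zero]

/-- The edge directions at `p T` of the elements of `T \ S` are a basis of the directions of the
face, since exchanging such an element keeps `S`. -/
lemma dim_faceHull_add (h : ExchangeSystem Q p l c) {S T : Set ι} (hT : Maximal Q T) (hST : S ⊆ T) :
    dim (faceHull Q p S) + S.ncard = T.ncard := by
  obtain ⟨d, hd, hpos, hzero⟩ := h.exists_directions hT
  have hTfin := h.finite_of T hT.1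
  have hspan : vectorSpan ℝ (faceHull Q p S) =
      Submodule.span ℝ (Set.range fun t : ↥(T \ S) => d t.1) := by
    refine le_antisymm (fun y hy => ?_) (Submodule.span_le.2 ?_)
    · have hy0 : ∀ t ∈ S, l t y = 0 := by
        intro t ht
        have hle : vectorSpan ℝ (faceHull Q p S) ≤ LinearMap.ker (l t).toLinearMap := by
          refine Submodule.span_le.2 ?_
          rintro _ ⟨a, ha, b, hb, rfl⟩
          simp [h.eq_of_mem ht ha, h.eq_of_mem ht hb]
        exact hle hy
      rw [h.eq_sum_directions hT hd hpos hzero (vectorSpan_faceHull_le S hy)]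
      refine Submodule.sum_mem _ fun t ht => ?_
      by_cases htS : t ∈ S
      · rw [hy0 t htS, zero_div, zero_smul]
        exact Submodule.zero_mem _
      · exact Submodule.smul_mem _ _ (Submodule.subset_span
          ⟨⟨t, hTfin.mem_toFinset.1 ht, htS⟩, rfl⟩)
    · rintro _ ⟨⟨t, ht, htS⟩, rfl⟩
      obtain ⟨T', hT', hsub, heq⟩ := hd t ht
      simp only [heq]
      exact vsub_mem_vectorSpan ℝ (mem_faceHull hT' fun u hu =>
        hsub ⟨hST hu, fun hut => htS (hut ▸ hu)⟩) (mem_faceHull hT hST)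
  have hfin : (T \ S).Finite := hTfin.subset Set.sdiff_subset
  have : Fintype ↥(T \ S) := hfin.fintype
  have hli : LinearIndependent ℝ fun t : ↥(T \ S) => d t.1 := by
    rw [Fintype.linearIndependent_iff]
    intro g hg t
    have h₁ := congrArg (l t.1) hg
    rw [map_sum, map_zero, Finset.sum_eq_single_of_mem t (Finset.mem_univ t), map_smul,
      smul_eq_mul] at h₁
    · exact (mul_eq_zero.1 h₁).resolve_right (hpos t.1 t.2.1).ne'
    · intro s _ hst
      rw [map_smul, hzero s.1 s.2.1 t.1 t.2.1 fun heq => hst (Subtype.ext heq.symm), smul_zero]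
  rw [dim, hspan, finrank_span_eq_card hli, ← Nat.card_eq_fintype_card, Nat.card_coe_set_eq]
  exact Set.ncard_sdiff_add_ncard_of_subset hST hTfin

lemma dim_faceHull (h : ExchangeSystem Q p l c) {S : Set ι} (hS : Q S) :
    dim (faceHull Q p S) + S.ncard = dim (faceHull Q p ∅) := by
  obtain ⟨T, hT, hST⟩ := h.exists_maximal S hS
  have h₁ := h.dim_faceHull_add hT hST
  have h₂ := h.dim_faceHull_add hT (Set.empty_subset T)
  simp only [Set.ncard_empty] at h₂
  omega

/-- Every nonempty exposed face is the convex hull of the points of a simplex. -/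
lemma exists_eq_faceHull (h : ExchangeSystem Q p l c) {F : Set W}
    (hF : IsExposed ℝ (faceHull Q p ∅) F) (hne : F.Nonempty) :
    ∃ S, Q S ∧ faceHull Q p S = F := by
  obtain ⟨g, rfl⟩ := hF hne
  obtain ⟨x₀, hx₀, hmax⟩ := hne
  obtain ⟨_, ⟨T, ⟨hT, -⟩, rfl⟩, hTx⟩ := (g.toLinearMap.convexOn
    (convex_convexHull ℝ (p '' {T | Maximal Q T ∧ ∅ ⊆ T}))).exists_ge_of_mem_convexHull
      (subset_convexHull ℝ _) hx₀
  have hgT : ∀ y ∈ faceHull Q p ∅, g y ≤ g (p T) := fun y hy => (hmax y hy).trans hTx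
  have hpT : p T ∈ faceHull Q p ∅ := mem_faceHull hT (Set.empty_subset T)
  obtain ⟨d, hd, hpos, hzero⟩ := h.exists_directions hT
  have hTfin := h.finite_of T hT.1
  have hgd : ∀ t ∈ T, g (d t) ≤ 0 := by
    intro t ht
    obtain ⟨T', hT', -, heq⟩ := hd t ht
    rw [heq, map_sub]
    linarith [hgT _ (mem_faceHull hT' (Set.empty_subset T'))]
  -- At the maximizing vertex `p T`, expanding `x - p T` in the edge directions writes `g x - g (p
  -- T)` as a sum of nonpositive terms. It vanishes exactly if the coefficient is zero for every `t`
  -- with `g (d t) ≠ 0`.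
  refine ⟨{t ∈ T | g (d t) ≠ 0}, h.subset T _ hT.1 (Set.sep_subset _ _), ?_⟩
  ext x
  rw [h.mem_faceHull_iff (h.subset T _ hT.1 (Set.sep_subset _ _))]
  refine and_congr_right fun hx => ?_
  have hexp : g x - g (p T) = ∑ t ∈ hTfin.toFinset,
      l t (x - p T) / l t (d t) * g (d t) := by
    rw [← map_sub]
    conv_lhs => rw [h.eq_sum_directions hT hd hpos hzero (sub_mem_vectorSpan hx hpT)]
    simp only [map_sum, map_smul, smul_eq_mul]
  have hterm : ∀ t ∈ hTfin.toFinset, l t (x - p T) / l t (d t) * g (d t) ≤ 0 := by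
    intro t ht
    have ht' := hTfin.mem_toFinset.1 ht
    refine mul_nonpos_of_nonneg_of_nonpos (div_nonneg ?_ (hpos t ht').le) (hgd t ht')
    rw [map_sub, h.eq T hT t ht', sub_nonneg]
    exact h.le_of_mem hT.1 ht' hx
  constructor
  · intro heq y hy
    refine (hgT y hy).trans ?_
    rw [← sub_nonneg, hexp]
    refine Finset.sum_nonneg fun t ht => ?_
    have ht' := hTfin.mem_toFinset.1 ht
    by_cases hgt : g (d t) = 0
    · rw [hgt, mul_zero]
    · rw [map_sub, h.eq T hT t ht', heq t ⟨ht', hgt⟩, sub_self, zero_div, zero_mul]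
  · rintro hxmax t ⟨ht, hgt⟩
    have h0 : ∑ t ∈ hTfin.toFinset, l t (x - p T) / l t (d t) * g (d t) = 0 := by
      refine le_antisymm (Finset.sum_nonpos hterm) ?_
      rw [← hexp, sub_nonneg]
      exact hxmax _ hpT
    have h1 := (Finset.sum_eq_zero_iff_of_nonpos hterm).1 h0 t (hTfin.mem_toFinset.2 ht)
    rcases mul_eq_zero.1 h1 with h2 | h2
    · rcases div_eq_zero_iff.1 h2 with h3 | h3
      · rw [map_sub, h.eq T hT t ht, sub_eq_zero] at h3
        exact h3
      · exact ((hpos t ht).ne' h3).elim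
    · exact (hgt h2).elim

lemma isPolytope (h : ExchangeSystem Q p l c) : IsPolytope (faceHull Q p ∅) :=
  ⟨_, (h.finite.subset fun _ hT => hT.1).image p, rfl⟩

/-- By the codimension formula the facets are the `faceHull Q p {t}`. Those through `p T` are the
ones with `t ∈ T`, and |T| is the dimension. -/
lemma isSimplePolytope (h : ExchangeSystem Q p l c) : IsSimplePolytope (faceHull Q p ∅) := by
  intro x hx
  obtain ⟨T, ⟨hT, -⟩, rfl⟩ := extremePoints_convexHull_subset hx
  have hsing : ∀ t ∈ T, Q {t} := fun t ht => h.subset T _ hT.1 (Set.singleton_subset_iff.2 ht)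
  have hdim := h.dim_faceHull_add hT (Set.empty_subset T)
  rw [Set.ncard_empty, add_zero] at hdim
  have hset : {F : Set W | IsExposed ℝ (faceHull Q p ∅) F ∧ F.Nonempty ∧
      dim F + 1 = dim (faceHull Q p ∅) ∧ p T ∈ F} = (fun t => faceHull Q p {t}) '' T := by
    ext F
    constructor
    · rintro ⟨hF, hne, hdF, hmem⟩
      obtain ⟨S, hS, rfl⟩ := h.exists_eq_faceHull hF hne
      have hcard : S.ncard = 1 := by
        have := h.dim_faceHull hS
        omega
      obtain ⟨t, rfl⟩ := Set.ncard_eq_one.1 hcard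
      refine ⟨t, ?_, rfl⟩
      by_contra htT
      obtain ⟨T', hT', htT'⟩ := h.exists_maximal _ hS
      exact (h.lt T T' hT hT' t (htT' rfl) htT).ne' (h.eq_of_mem (Set.mem_singleton t) hmem)
    · rintro ⟨t, ht, rfl⟩
      have := h.dim_faceHull (hsing t ht)
      rw [Set.ncard_singleton] at this
      exact ⟨h.isExposed_faceHull (hsing t ht), h.nonempty_faceHull (hsing t ht), this,
        mem_faceHull hT (Set.singleton_subset_iff.2 ht)⟩
  rw [hset, Set.InjOn.ncard_image, hdim]
  intro t ht s hs hts
  have := (h.faceHull_subset_iff (hsing t ht) (hsing s hs)).1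
    (show faceHull Q p {t} ≤ _ from hts.le)
  exact (this (Set.mem_singleton s)).symm

/-- The order isomorphism from the simplices, ordered by reverse inclusion, onto the nonempty
faces of the polytope. -/
theorem exists_orderIso (h : ExchangeSystem Q p l c) :
    ∃ φ : {S : Set ι // Q S}ᵒᵈ ≃o Face (faceHull Q p ∅),
    ∀ S : {S : Set ι // Q S}, (φ (OrderDual.toDual S)).1 = faceHull Q p S.1 := by
  let emb : {S : Set ι // Q S}ᵒᵈ ↪o Face (faceHull Q p ∅) := OrderEmbedding.ofMapLEIff
    (fun S => ⟨faceHull Q p (OrderDual.ofDual S).1,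
      h.isExposed_faceHull (OrderDual.ofDual S).2, h.nonempty_faceHull (OrderDual.ofDual S).2⟩)
    (fun S S' => h.faceHull_subset_iff (OrderDual.ofDual S).2 (OrderDual.ofDual S').2)
  refine ⟨RelIso.ofSurjective emb fun F => ?_, fun S => rfl⟩
  obtain ⟨S, hS, hF⟩ := h.exists_eq_faceHull F.2.1 F.2.2
  exact ⟨OrderDual.toDual ⟨S, hS⟩, Subtype.ext hF⟩

end ExchangeSystem

end Polytopes

/-! ### The number of tubes of a maximal tubing -/

section Counting

open Classical

variable {α β : Type*} {G : Graph α β} {T : Set (Graph α β)} [Fintype V(G)] [Fintype E(G)]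

/-- The smallest tubes of the nodes, and of the edges that are not the first ones of their
bundles, are the members of `insert G T`. -/
lemma IsMaximalTubing.ncard_add_one (hG : IsConnected G ∨ G.Simple) (hT : IsMaximalTubing G T) :
    T.ncard + 1 = Fintype.card V(G) +
      (Finset.univ.filter fun e : E(G) => edgeRank T e ≠ 1).card := by
  have hTfin : T.Finite := hT.1.finite (Set.toFinite _) (Set.toFinite _)
  have hGT : G ∉ T := fun h => (hT.1.tube G h).ne rfl
  have hr : ∀ e : E(G), edgeRank T e ≠ 1 → ∃ e' ∈ E(edgeTube G T e.1), e' ≠ e.1 ∧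
      Parallel G e.1 e' := fun e he => by
    have := one_le_edgeRank hT.1 e
    exact (two_le_edgeRank_iff hT.1 e).1 (by omega)
  let m : V(G) ⊕ {e : E(G) // edgeRank T e ≠ 1} → ↥(insert G T) :=
    Sum.elim (fun x => ⟨nodeTube G T x.1, (hT.1.nodeTube_spec x).1⟩)
      (fun e => ⟨edgeTube G T e.1.1, (hT.1.edgeTube_spec e.1).1⟩)
  have hmix : ∀ (x : V(G)) (e : E(G)), edgeRank T e ≠ 1 →
      nodeTube G T x.1 ≠ edgeTube G T e.1 := by
    intro x e he heq
    obtain ⟨e', he', hne, hp⟩ := hr e he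
    have hx := (hT.1.nodeTube_spec x).2
    rw [heq] at hx
    exact (hT.1.edgeTube_spec e).2.not_newNode hG hT (hT.1.edgeTube_spec e).1 hp hne he' hx
  have hbij : Function.Bijective m := by
    constructor
    · rintro (x | e) (y | f) h
      · have heq : nodeTube G T x.1 = nodeTube G T y.1 := congrArg Subtype.val h
        have hx := hT.1.nodeTube_spec x
        have hy := hT.1.nodeTube_spec y
        rw [← heq] at hy
        rw [Subtype.ext (hx.2.eq hT hx.1 hy.2)]
      · exact (hmix x f.1 f.2 (congrArg Subtype.val h)).elim
      · exact (hmix y e.1 e.2 (congrArg Subtype.val h).symm).elim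
      · have heq : edgeTube G T e.1.1 = edgeTube G T f.1.1 := congrArg Subtype.val h
        obtain ⟨e', he', hne, hp⟩ := hr e.1 e.2
        have he := hT.1.edgeTube_spec e.1
        have hf := hT.1.edgeTube_spec f.1
        rw [← heq] at hf
        rw [Subtype.ext (Subtype.ext (he.2.eq hG hT he.1 hp hne he' hf.2)).symm]
    -- Injectivity was the uniqueness of the essential new element; surjectivity is its existence.
    · rintro ⟨τ, hτ⟩
      have hτG := hT.1.le hτ
      rcases hT.1.exists_main (Set.toFinite _) (Set.toFinite _) hτ with ⟨w, hw⟩ | ⟨e, he, hpar⟩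
      · exact ⟨.inl ⟨w, hτG.vertexSet_mono hw.mem⟩, Subtype.ext (hT.1.nodeTube_eq _ hτ hw)⟩
      · obtain ⟨e, rfl⟩ : ∃ y : E(G), y.1 = e := ⟨⟨e, hτG.edgeSet_mono he.mem⟩, rfl⟩
        have heq := hT.1.edgeTube_eq e hτ he
        have h2 : 2 ≤ edgeRank T e := (two_le_edgeRank_iff hT.1 e).2 (heq ▸ hpar)
        exact ⟨.inr ⟨e, by omega⟩, Subtype.ext heq⟩
  rw [← Set.ncard_insert_of_notMem hGT hTfin, ← Nat.card_coe_set_eq,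
    ← Nat.card_eq_of_bijective m hbij, Nat.card_sum, Nat.card_eq_fintype_card,
    Nat.card_eq_fintype_card, Fintype.card_subtype (fun e : E(G) => edgeRank T e ≠ 1)]

/-- The edges that are not the first ones of their bundles are a smallest set of edges whose
removal leaves a simple graph. -/
lemma IsMaximalTubing.redundantEdges_eq (hl : G.Loopless) (hG : IsConnected G ∨ G.Simple)
    (hT : IsMaximalTubing G T) :
    redundantEdges G = (Finset.univ.filter fun e : E(G) => edgeRank T e ≠ 1).card := by
  set R : Finset E(G) := Finset.univ.filter fun e : E(G) => edgeRank T e ≠ 1 with hR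
  have hloop : (G.deleteEdges (Subtype.val '' (R : Set E(G)))).Loopless :=
    Graph.Loopless.anti Graph.deleteEdges_le
  have hmem : R.card ∈ {m | ∃ F ⊆ E(G), (G.deleteEdges F).Simple ∧ F.ncard = m} := by
    refine ⟨Subtype.val '' (R : Set E(G)), ?_, { hloop with eq_of_isLink := ?_ }, ?_⟩
    · rintro _ ⟨e, -, rfl⟩
      exact e.2
    · intro e f x y he hf
      simp only [Graph.deleteEdges_isLink] at he hf
      have key : ∀ g (hg : G.IsLink g x y), g ∉ Subtype.val '' (R : Set E(G)) →
          edgeRank T (⟨g, hg.edge_mem⟩ : E(G)) = 1 := by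
        intro g hg hgR
        by_contra hne
        exact hgR ⟨⟨g, hg.edge_mem⟩, by simpa [hR] using hne, rfl⟩
      have := hT.edgeRank_injective hG (e := ⟨e, he.1.edge_mem⟩) (e' := ⟨f, hf.1.edge_mem⟩)
        ⟨x, y, he.1, hf.1⟩ ((key e he.1 he.2).trans (key f hf.1 hf.2).symm)
      exact congrArg Subtype.val this
    · rw [Set.ncard_image_of_injective _ Subtype.val_injective, Set.ncard_coe_finset]
  refine le_antisymm (Nat.sInf_le hmem) (le_csInf ⟨_, hmem⟩ ?_)
  rintro _ ⟨F, hF, hsimple, rfl⟩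
  have hFcard : F.ncard = (Finset.univ.filter fun e : E(G) => e.1 ∈ F).card := by
    rw [← Set.ncard_coe_finset, ← Set.ncard_image_of_injective _ Subtype.val_injective]
    congr 1
    ext x
    simpa using fun h => hF h
  have hfirst : ∀ e : E(G), ∃ y : E(G), Parallel G e.1 y.1 ∧ edgeRank T y = 1 := fun e =>
    hT.exists_edgeRank hG e le_rfl (Finset.card_pos.2 ⟨e, self_mem_bundle e⟩)
  choose o hop hor using hfirst
  -- The edges that survive the removal of `F` lie in distinct bundles, so sending each to the first
  -- edge of its bundle is injective.
  have hle : (Finset.univ.filter fun e : E(G) => ¬ e.1 ∈ F).card ≤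
      (Finset.univ.filter fun e : E(G) => ¬ edgeRank T e ≠ 1).card := by
    refine Finset.card_le_card_of_injOn o (fun e _ => by simp [hor]) fun e he f hf hef => ?_
    simp only [Finset.coe_filter, Finset.mem_univ, true_and, Set.mem_ofPred_eq] at he hf
    obtain ⟨x, y, h₁, h₂⟩ := (hop e).trans (hef ▸ (hop f).symm)
    refine Subtype.ext (hsimple.eq_of_isLink (x := x) (y := y) ?_ ?_)
    · simpa using ⟨h₁, he⟩
    · simpa using ⟨h₂, hf⟩
  have e₁ := Finset.card_filter_add_card_filter_not (s := Finset.univ)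
    (fun e : E(G) => e.1 ∈ F)
  have e₂ := Finset.card_filter_add_card_filter_not (s := Finset.univ)
    (fun e : E(G) => edgeRank T e ≠ 1)
  rw [← hR] at e₂
  rw [hFcard]
  omega

end Counting

/-! ### The realization -/

section Realization

open Classical

variable {α β : Type*} {G : Graph α β} {T : Set (Graph α β)} [Fintype V(G)] [Fintype E(G)]
  {n k : ℕ}

/-- The sum of the coordinates of the nodes in `A` and the edges in `S`. -/
noncomputable def coordinateSum (v : Fin n ≃ V(G)) (e : Fin k ≃ E(G)) (A : Finset V(G))
    (S : Finset E(G)) : (Fin (n + k) → ℝ) →L[ℝ] ℝ :=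
  ∑ x ∈ A, ContinuousLinearMap.proj (Fin.castAdd k (v.symm x)) +
    ∑ y ∈ S, ContinuousLinearMap.proj (Fin.natAdd n (e.symm y))

lemma coordinateSum_apply (v : Fin n ≃ V(G)) (e : Fin k ≃ E(G)) (A : Finset V(G))
    (S : Finset E(G)) (z : Fin (n + k) → ℝ) : coordinateSum v e A S z =
      ∑ x ∈ A, z (Fin.castAdd k (v.symm x)) + ∑ y ∈ S, z (Fin.natAdd n (e.symm y)) := by
  simp [coordinateSum]

lemma coordinateSum_point (v : Fin n ≃ V(G)) (e : Fin k ≃ E(G)) (A : Finset V(G))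
    (S : Finset E(G)) (f : V(G) ⊕ E(G) → ℤ) : coordinateSum v e A S (point v e f) =
      ((∑ x ∈ A, f (.inl x) + ∑ y ∈ S, f (.inr y) : ℤ) : ℝ) := by
  simp [coordinateSum_apply, point]

/-- The point attached to the maximal tubing `T`. -/
noncomputable def vertexPoint (v : Fin n ≃ V(G)) (e : Fin k ≃ E(G)) (T : Set (Graph α β)) :
    Fin (n + k) → ℝ :=
  point v e (Classical.epsilon (IsVertexFunction G T))

lemma IsMaximalTubing.epsilon_spec (hG : IsConnected G ∨ G.Simple) (hT : IsMaximalTubing G T) :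
    IsVertexFunction G T (Classical.epsilon (IsVertexFunction G T)) :=
  Classical.epsilon_spec (hT.existsUnique_isVertexFunction hG).exists

lemma points_eq (hG : IsConnected G ∨ G.Simple) (v : Fin n ≃ V(G)) (e : Fin k ≃ E(G))
    (S : Set (Graph α β)) :
    points v e S = vertexPoint v e '' {T | Maximal (IsTubing G) T ∧ S ⊆ T} := by
  ext z
  constructor
  · rintro ⟨T, f, hT, hST, hf, rfl⟩
    refine ⟨T, ⟨hT, hST⟩, ?_⟩
    rw [vertexPoint, (hT.existsUnique_isVertexFunction hG).unique (hT.epsilon_spec hG) hf]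
  · rintro ⟨T, ⟨hT, hST⟩, rfl⟩
    exact ⟨T, _, hT, hST, IsMaximalTubing.epsilon_spec hG hT, rfl⟩

lemma excess_eq_coordinateSum (v : Fin n ≃ V(G)) (e : Fin k ≃ E(G)) (f : V(G) ⊕ E(G) → ℤ)
    (t : Graph α β) : coordinateSum v e (nodes G t) (edges G t) (point v e f) - tubeValue G t =
      (excess f t : ℝ) := by
  rw [coordinateSum_point, excess, sumOver_eq]
  push_cast
  ring

/-- A functional that is constant on a set vanishes on its directions. -/
lemma apply_eq_zero_of_mem_vectorSpan {W : Type*} [AddCommGroup W] [Module ℝ W]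
    [TopologicalSpace W] {A : Set W} (g : W →L[ℝ] ℝ) (r : ℝ) (hg : ∀ x ∈ A, g x = r) {y : W}
    (hy : y ∈ vectorSpan ℝ A) : g y = 0 := by
  have hle : vectorSpan ℝ A ≤ LinearMap.ker g.toLinearMap := by
    refine Submodule.span_le.2 ?_
    rintro _ ⟨a, ha, b, hb, rfl⟩
    simp [hg a ha, hg b hb]
  exact hle hy

/-- The points attached to the maximal tubings form an exchange system. -/
theorem exchangeSystem (hl : G.Loopless) (hG : IsConnected G ∨ G.Simple) (v : Fin n ≃ V(G))
    (e : Fin k ≃ E(G)) : ExchangeSystem (IsTubing G) (vertexPoint v e)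
      (fun t => coordinateSum v e (nodes G t) (edges G t)) (fun t => (tubeValue G t : ℝ)) where
  finite := (finite_tubings (Set.toFinite V(G)) (Set.toFinite E(G))).subset fun _ hT => hT.1
  finite_of _ hS := hS.finite (Set.toFinite _) (Set.toFinite _)
  subset _ _ hT h := hT.subset h
  exists_maximal _ hS := hS.exists_maximal (Set.toFinite _) (Set.toFinite _)
  eq T hT t ht := by
    rw [← sub_eq_zero, vertexPoint, excess_eq_coordinateSum,
      (IsMaximalTubing.epsilon_spec hG hT).excess_eq_zero (.inr ht), Int.cast_zero]
  lt T T' hT hT' t ht htT := by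
    have htube := hT'.1.tube t ht
    rw [← sub_pos, vertexPoint, excess_eq_coordinateSum, Int.cast_pos]
    exact (IsMaximalTubing.epsilon_spec hG hT).excess_pos hG hl hT htube.isFull htube.connected
      fun h => h.elim htube.ne htT
  flip T hT t ht := IsMaximalTubing.exists_flip hG (Set.toFinite _) (Set.toFinite _) hT ht
  separate T hT y hy hty := by
    -- The bundle sums and the total sum are the same at all vertices, so they vanish on every
    -- direction of the polytope. Together with the tubes of `T` they determine the direction.
    have hB : ∀ b : E(G), ∑ z ∈ bundleOf b, y (Fin.natAdd n (e.symm z)) = 0 := by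
      intro b
      have := apply_eq_zero_of_mem_vectorSpan (coordinateSum v e ∅ (bundleOf b))
        ((base G ^ (bundleOf b).card : ℤ) : ℝ) ?_ hy
      · simpa [coordinateSum_apply] using this
      · rintro _ ⟨T', hT', rfl⟩
        rw [vertexPoint, coordinateSum_point, Finset.sum_empty, zero_add,
          sum_bundle_of_isVertexFunction hG hT' (IsMaximalTubing.epsilon_spec hG hT')]
    have hs : ∀ τ ∈ insert G T, coordinateSum v e (nodes G τ) (edges G τ) y = 0 := by
      rintro τ (rfl | hτ)
      · refine apply_eq_zero_of_mem_vectorSpan _ (tubeValue τ τ : ℝ) ?_ hy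
        rintro _ ⟨T', hT', rfl⟩
        rw [← sub_eq_zero, vertexPoint, excess_eq_coordinateSum,
          (IsMaximalTubing.epsilon_spec hG hT').excess_eq_zero (Set.mem_insert _ _), Int.cast_zero]
      · exact hty τ hτ
    obtain ⟨h₁, h₂⟩ := IsMaximalTubing.eq_zero_of_sums hG hT
      (g := fun x => y (Fin.castAdd k (v.symm x))) (h := fun z => y (Fin.natAdd n (e.symm z))) hB
      fun τ hτ => by rw [← coordinateSum_apply]; exact hs τ hτ
    funext i
    refine Fin.addCases (fun i => ?_) (fun j => ?_) i
    · simpa using congrFun h₁ (v i)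
    · simpa using congrFun h₂ (e j)

end Realization

end PseudographAssociahedron

/-! ### Assembly of the theorem -/

open scoped Graph in
open PseudographAssociahedron in
theorem theorem11 {α β : Type*} (G : Graph α β) (hloop : G.Loopless)
    (hG : IsConnected G ∨ G.Simple)
    (n k : ℕ) (hn : 1 ≤ n) (v : Fin n ≃ V(G)) (e : Fin k ≃ E(G)) :
    (∀ T, IsMaximalTubing G T → ∃! f : V(G) ⊕ E(G) → ℤ, IsVertexFunction G T f) ∧
    ∃ φ : {T : Set (Graph α β) // IsTubing G T}ᵒᵈ ≃o Face (hull v e),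
      IsAssociahedron G (hull v e) φ ∧
      ∀ T : {T : Set (Graph α β) // IsTubing G T},
        (φ (OrderDual.toDual T)).1 = convexHull ℝ (points v e T.1) := by
  have : Fintype V(G) := Fintype.ofEquiv _ v
  have : Fintype E(G) := Fintype.ofEquiv _ e
  refine ⟨fun T hT => hT.existsUnique_isVertexFunction hG, ?_⟩
  have hsys := exchangeSystem hloop hG v e
  have hhull : ∀ S, convexHull ℝ (points v e S) = faceHull (IsTubing G) (vertexPoint v e) S :=
    fun S => by rw [points_eq hG, faceHull]
  have hempty : IsTubing G ∅ := isTubing_empty ⟨_, (v ⟨0, hn⟩).2⟩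
  obtain ⟨T, hT, -⟩ := hsys.exists_maximal ∅ hempty
  have hdim := hsys.dim_faceHull_add hT (Set.empty_subset T)
  rw [Set.ncard_empty, add_zero] at hdim
  obtain ⟨φ, hφ⟩ := hsys.exists_orderIso
  rw [show hull v e = _ from hhull ∅]
  refine ⟨φ, ⟨hsys.isPolytope, hsys.isSimplePolytope, ?_, fun S => ?_⟩, fun S => ?_⟩
  · rw [hdim, IsMaximalTubing.ncard_add_one hG hT, IsMaximalTubing.redundantEdges_eq hloop hG hT,
      ← Nat.card_coe_set_eq, Nat.card_eq_fintype_card]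
  · rw [hφ]
    exact hsys.dim_faceHull S.2
  · rw [hφ, hhull]
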